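/- Let $X$ and $Y$ be compact connected complex manifolds, $M = X\times Y$, with projections $\pi_1 : M\to X$ and $\pi_2 : M\to Y$. Let $\phi_1,\dots,\phi_r$ be a basis of the complex vector space $H^{1,0}(X)$ of holomorphic $1$-forms on $X$, and $\psi_1,\dots,\psi_s$ a basis of $H^{1,0}(Y)$. For a (smooth, not necessarily Kähler) Hermitian metric $h$, written $h_{i\bar j}$ in local holomorphic coordinates, let $\omega_h = \sqrt{-1}\sum h_{i\bar j}\,dz^i\wedge d\bar z^j$ be its Kähler form, let $$R_{i\bar j k\bar l} = -\partial_k\partial_{\bar l} h_{i\bar j} + \sum_{a,b} h^{\bar b a}\,\partial_k h_{i\bar b}\,\partial_{\bar l} h_{a\bar j}$$ be the curvature tensor of its Chern connection, and say that $h$ has nonpositive holomorphic bisectional curvature if $R(u,\bar u,v,\bar v)/(|u|_h^2|v|_h^2)\le 0$ for all nonzero holomorphic tangent vectors $u,v$ at the same point. Then for every Hermitian metric $h$ on $M$ with nonpositive holomorphic bisectional curvature there are Hermitian metrics $h_1$ on $X$ and $h_2$ on $Y$, each with nonpositive holomorphic bisectional curvature, and complex numbers $a_{kl}$ ($1\le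 k\le r$, $1\le l\le s$), such that $$\omega_h = \pi_1^*\omega_{h_1} + \pi_2^*\omega_{h_2} + \rho + \bar\rho, \qquad \rho = \sqrt{-1}\sum_{k=1}^{r}\sum_{l=1}^{s} a_{kl}\,\pi_1^*\phi_k\wedge\overline{\pi_2^*\psi_l}.$$ -/

import Mathlib

open scoped Manifold ContDiff ComplexConjugate

noncomputable section

namespace ComplexProduct

section Wirtinger

variable {E F : Type*} [NormedAddCommGroup E] [NormedSpace ℂ E]
  [NormedAddCommGroup F] [NormedSpace ℂ F]

/-- The derivative `∂_v f = (D f(z) v - √-1 D f(z) (√-1 v)) / 2` of type `(1,0)` of a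
real-differentiable function `f`, in the direction `v`. For `v` the `k`-th coordinate vector this is
`∂f / ∂z^k`. -/
def del (v : E) (f : E → F) (z : E) : F :=
  (1 / 2 : ℂ) • (fderiv ℝ f z v - Complex.I • fderiv ℝ f z (Complex.I • v))

/-- The derivative `(D f(z) v + √-1 D f(z) (√-1 v)) / 2` of type `(0,1)` of a
real-differentiable function `f`. For `v` the `k`-th coordinate vector this is
the derivative of `f` with respect to the conjugate of `z^k`. -/
def delBar (v : E) (f : E → F) (z : E) : F :=
  (1 / 2 : ℂ) • (fderiv ℝ f z v + Complex.I • fderiv ℝ f z (Complex.I • v))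

end Wirtinger

section PullSesq

variable {E F : Type*} [NormedAddCommGroup E] [NormedSpace ℂ E]
  [NormedAddCommGroup F] [NormedSpace ℂ F]

/-- The pullback `(u, v) ↦ B (D u) (D v)` of a sesquilinear form `B`, which is linear in the first
variable and conjugate-linear in the second one. -/
def pullSesq (D : E →L[ℂ] F) (B : F →L[ℂ] F →L⋆[ℂ] ℂ) : E →L[ℂ] E →L⋆[ℂ] ℂ :=
  B.bilinearComp D D

theorem pullSesq_apply (D : E →L[ℂ] F) (B : F →L[ℂ] F →L⋆[ℂ] ℂ) (u v : E) :
    pullSesq D B u v = B (D u) (D v) := rfl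

end PullSesq

section Manifold

variable {E : Type*} [NormedAddCommGroup E] [NormedSpace ℂ E] {H : Type*} [TopologicalSpace H]
  (I : ModelWithCorners ℂ E H) {M : Type*} [TopologicalSpace M] [ChartedSpace H M]

/-- The differential at `z` of the holomorphic parametrization which is inverse to the coordinate
chart of `M` around `c`. It sends the `i`-th coordinate vector to `∂ / ∂z^i`. -/
def coordFrame (c : M) (z : E) : E →L[ℂ] TangentSpace I ((extChartAt I c).symm z) :=
  mfderiv 𝓘(ℂ, E) I (extChartAt I c).symm z

/-- The coefficients, in the coordinate chart around `c`, of a field `g` of sesquilinear forms: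
the matrix `h_{i \bar j}(z)`, written without choosing a basis as a sesquilinear form on `E`. -/
def coordSesq (g : ∀ p : M, TangentSpace I p →L[ℂ] TangentSpace I p →L⋆[ℂ] ℂ) (c : M) (z : E) :
    E →L[ℂ] E →L⋆[ℂ] ℂ :=
  pullSesq (F := E) (coordFrame I c z) (g ((extChartAt I c).symm z))

/-- The coefficients, in the coordinate chart around `c`, of a field `φ` of complex linear forms,
that is, of a form of type `(1,0)`. -/
def coordOneForm (φ : ∀ p : M, TangentSpace I p →L[ℂ] ℂ) (c : M) (z : E) : E →L[ℂ] ℂ :=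
  (φ ((extChartAt I c).symm z)).comp (coordFrame I c z)

variable (M) in
/-- A (smooth) Hermitian metric on a complex manifold (without boundary). The holomorphic tangent
space at `p` is the complex vector space `TangentSpace I p`. -/
structure HermitianMetric where
  /-- The Hermitian form at `p`, linear in the first and conjugate-linear in the second variable. -/
  form : ∀ p : M, TangentSpace I p →L[ℂ] TangentSpace I p →L⋆[ℂ] ℂ
  conj_symm : ∀ (p : M) (u v : TangentSpace I p), conj (form p u v) = form p v u
  pos : ∀ (p : M) (u : TangentSpace I p), u ≠ 0 → 0 < (form p u u).re
  smooth : ∀ c : M, ContDiffOn ℝ ∞ (coordSesq I form c) (extChartAt I c).target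

variable (M) in
/-- The complex vector space `H^{1,0}(M)` of holomorphic `1`-forms on `M`: the forms of type `(1,0)`
whose coefficients in holomorphic coordinates are holomorphic. -/
def HolomorphicOneForm : Submodule ℂ (∀ p : M, TangentSpace I p →L[ℂ] ℂ) where
  carrier := {φ | ∀ c : M, DifferentiableOn ℂ (coordOneForm I φ c) (extChartAt I c).target}
  add_mem' := fun {_ _} ha hb c => (ha c).add (hb c)
  zero_mem' := fun _ => differentiableOn_const (0 : E →L[ℂ] ℂ)
  smul_mem' := fun a _ hb c => (hb c).const_smul a

variable (M) in
/-- A field of complex valued real-linear forms: a complex `1`-form, not assumed continuous. -/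
abbrev OneForm := ∀ p : M, TangentSpace I p →ₗ[ℝ] ℂ

variable (M) in
/-- A field of complex valued real-bilinear alternating forms: a complex `2`-form, not assumed
continuous. -/
abbrev TwoForm := ∀ p : M, TangentSpace I p [⋀^Fin 2]→ₗ[ℝ] ℂ

/-- A holomorphic `1`-form, as a complex `1`-form. -/
def HolomorphicOneForm.toOneForm {I : ModelWithCorners ℂ E H} (φ : HolomorphicOneForm I M) :
    OneForm I M :=
  fun p => ((φ : ∀ p : M, TangentSpace I p →L[ℂ] ℂ) p).toLinearMap.restrictScalars ℝ

/-- The exterior product `(u, v) ↦ α(u) β(v) - α(v) β(u)` of two linear forms. -/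
def wedgeLin {V : Type*} [AddCommGroup V] [Module ℝ V] (α β : V →ₗ[ℝ] ℂ) : V [⋀^Fin 2]→ₗ[ℝ] ℂ where
  toFun v := α (v 0) * β (v 1) - α (v 1) * β (v 0)
  map_update_add' := by
    intro inst v i x y
    rw [Subsingleton.elim inst (instDecidableEqFin 2)]
    fin_cases i <;> simp <;> ring
  map_update_smul' := by
    intro inst v i a x
    rw [Subsingleton.elim inst (instDecidableEqFin 2)]
    fin_cases i <;> simp <;> ring
  map_eq_zero_of_eq' := by
    intro v i j hv hij
    fin_cases i <;> fin_cases j <;> simp_all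

variable {I}

/-- The exterior product of two complex `1`-forms. -/
def OneForm.wedge (α β : OneForm I M) : TwoForm I M := fun p => wedgeLin (α p) (β p)

/-- The complex conjugate of a complex `1`-form. -/
def OneForm.conj (α : OneForm I M) : OneForm I M :=
  fun p => Complex.conjAe.toLinearMap ∘ₗ α p

/-- The complex conjugate of a complex `2`-form. -/
def TwoForm.conj (η : TwoForm I M) : TwoForm I M :=
  fun p => Complex.conjAe.toLinearMap.compAlternatingMap (η p)

section Pullback

variable {E' : Type*} [NormedAddCommGroup E'] [NormedSpace ℂ E'] {H' : Type*} [TopologicalSpace H']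
  {I' : ModelWithCorners ℂ E' H'} {N : Type*} [TopologicalSpace N] [ChartedSpace H' N]

variable (I) in
/-- The pullback `f^* α` of a complex `1`-form along a holomorphic map `f`. -/
def OneForm.pullback (f : M → N) (α : OneForm I' N) : OneForm I M :=
  fun p => α (f p) ∘ₗ (mfderiv I I' f p).toLinearMap.restrictScalars ℝ

variable (I) in
/-- The pullback `f^* η` of a complex `2`-form along a holomorphic map `f`. -/
def TwoForm.pullback (f : M → N) (η : TwoForm I' N) : TwoForm I M :=
  fun p => (η (f p)).compLinearMap ((mfderiv I I' f p).toLinearMap.restrictScalars ℝ)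

end Pullback

namespace HermitianMetric

variable (h : HermitianMetric I M)

/-- The Kähler form `ω_h = √-1 ∑ h_{i \bar j} dz^i ∧ d\bar z^j` of a Hermitian metric, that is,
`ω_h(u, v) = √-1 (h(u, v) - h(v, u))`. -/
def kahlerForm : TwoForm I M := fun p =>
  { toFun := fun v => Complex.I * (h.form p (v 0) (v 1) - h.form p (v 1) (v 0))
    map_update_add' := by
      intro inst v i x y
      rw [Subsingleton.elim inst (instDecidableEqFin 2)]
      fin_cases i <;> simp <;> ring
    map_update_smul' := by
      intro inst v i a x
      rw [Subsingleton.elim inst (instDecidableEqFin 2)]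
      have e₂ : ∀ w w' : TangentSpace I p, h.form p w (a • w') = a * h.form p w w' := fun w w' => by
        change h.form p w ((a : ℂ) • w') = a * h.form p w w'
        rw [map_smulₛₗ, Complex.conj_ofReal]; rfl
      fin_cases i <;> simp [e₂] <;> ring
    map_eq_zero_of_eq' := by
      intro v i j hv hij
      fin_cases i <;> fin_cases j <;> simp_all }

/-- The coefficients `h_{i \bar j}` of the metric in the coordinate chart around `c`, as a
sesquilinear form on `E` that depends on the point `z` of the chart. -/
def coord (c : M) : E → E →L[ℂ] E →L⋆[ℂ] ℂ := coordSesq I h.form c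

/-- The curvature tensor `R(u, \bar w, v, \bar t)` of the Chern connection, at the point with
coordinates `z` in the chart around `c`. Since `h.coord c z` is inverted as a map from `E` to the
conjugate-linear forms, this is the basis-free form of
`R_{i \bar j k \bar l} = - ∂_k ∂_{\bar l} h_{i \bar j}
  + ∑ h^{\bar b a} ∂_k h_{i \bar b} ∂_{\bar l} h_{a \bar j}`. -/
def chernCurvature (c : M) (z u w v t : E) : ℂ :=
  - del v (delBar t (h.coord c)) z u w
    + delBar t (h.coord c) z ((h.coord c z).inverse (del v (h.coord c) z u)) w

/-- The holomorphic bisectional curvature `R(u, \bar u, v, \bar v) / (|u|^2 |v|^2)`. -/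
def bisectionalCurvature (c : M) (z u v : E) : ℝ :=
  (h.chernCurvature c z u u v v).re / ((h.coord c z u u).re * (h.coord c z v v).re)

/-- The holomorphic bisectional curvature is nonpositive at every point, for all nonzero holomorphic
tangent vectors `u` and `v`. -/
def NonposBisectionalCurvature : Prop :=
  ∀ c : M, ∀ z ∈ (extChartAt I c).target, ∀ u v : E, u ≠ 0 → v ≠ 0 →
    h.bisectionalCurvature c z u v ≤ 0

end HermitianMetric

end Manifold

end ComplexProduct

end

open ComplexProduct

/-! Fix a tangent vector `u` of `X` at `x`. The function `y ↦ h(u, u)` at `(x, y)` is globally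
defined on `Y`. In product coordinates `u` is a constant vector, and nonpositive curvature says that
for `v` tangent to `Y` the value `∂_v ∂̄_v h(u, u)` is at least `|a|²`, where `a` is the vector with
`h(a, ·) = ∂_v h(u, ·)`. The function is therefore plurisubharmonic, hence constant on the compact
connected `Y`. Its Levi form then vanishes, which forces `a = 0`, so the whole form `∂_v h(u, ·)` is
zero.

This has two consequences. By polarization the `X`-block of `h` does not depend on `y`. By Hermitian
symmetry `∂̄_v h(·, u) = 0` along `Y`, so `h(·, u)` restricts to a holomorphic `1`-form on `Y`. The
same holds with the factors exchanged. The mixed block is thus a combination of the `φ k` in one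
variable and, after conjugation, of the `ψ l` in the other; linear algebra gives the constants `a k
l`. The diagonal blocks are the metrics induced on slices, whose curvature is nonpositive by the
Griffiths inequality.

The main steps are `eq_of_leviNonneg_of_compact`,
`NonposBisectionalCurvature.eq_const_and_del_eq_zero`, `NonposBisectionalCurvature.of_slice`,
`mem_holomorphicOneForm_of_del_eq_zero` and `exists_coeff_of_separately_span`. -/

namespace ComplexProduct

open scoped Topology

/-! ### The maximum principle for plurisubharmonic functions -/

section MaximumPrinciple

open Set Metric MeasureTheory

section ParametricIntegral

theorem hasDerivAt_intervalIntegral_of_continuousOn {F F' : ℝ → ℝ → ℝ} {s : Set ℝ} (hs : IsOpen s)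
    {a b : ℝ} (hF : ∀ t ∈ s, ∀ θ, HasDerivAt (fun t => F t θ) (F' t θ) t)
    (hFc : ∀ t ∈ s, Continuous (F t))
    (hF' : ContinuousOn (fun q : ℝ × ℝ => F' q.1 q.2) (s ×ˢ univ)) {t : ℝ} (ht : t ∈ s) :
    HasDerivAt (fun t => ∫ θ in a..b, F t θ) (∫ θ in a..b, F' t θ) t := by
  -- The constant dominating the derivative comes from compactness of a closed interval around `t`
  -- times `[a, b]`.
  obtain ⟨ε, hε, hsub⟩ := Metric.nhds_basis_closedBall.mem_iff.1 (hs.mem_nhds ht)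
  have hK : IsCompact (closedBall t ε ×ˢ uIcc a b) :=
    (isCompact_closedBall t ε).prod isCompact_uIcc
  obtain ⟨C, hC⟩ := hK.exists_bound_of_continuousOn
    (hF'.mono (prod_mono hsub (subset_univ _)))
  have hcont : ∀ t ∈ s, Continuous (F' t) := fun t ht => by
    rw [← continuousOn_univ]
    exact hF'.comp (f := fun θ => (t, θ)) (by fun_prop) (fun θ _ => ⟨ht, mem_univ _⟩)
  refine (intervalIntegral.hasDerivAt_integral_of_dominated_loc_of_deriv_le
    (bound := fun _ => C) (closedBall_mem_nhds t hε) ?_ ?_ ?_ ?_ ?_ ?_).2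
  · filter_upwards [hs.mem_nhds ht] with x hx using (hFc x hx).aestronglyMeasurable
  · exact (hFc t ht).intervalIntegrable _ _
  · exact (hcont t ht).aestronglyMeasurable
  · exact Filter.Eventually.of_forall fun θ hθ x hx =>
      hC (x, θ) ⟨hx, uIoc_subset_uIcc hθ⟩
  · exact intervalIntegrable_const
  · exact Filter.Eventually.of_forall fun θ _ x hx => hF x (hsub hx) θ

/-- Here `A` and `B` are the first two radial derivatives of `F`, `C` stands for the second
derivative in the angular unit direction, and `K` for the first one. Since `∂_θ K = t C - A`
integrates to zero over a period, `(t ∫ A)' = ∫ (A + t B) = t ∫ (B + C) ≥ 0`. Hence `t ∫ A ≥ 0` for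
`t ≥ 0`, and the circle integral of `F` increases with the radius. Negative radii are allowed so
that all derivatives at `t = 0` are two-sided. -/
theorem integral_zero_le_of_polar_laplacian_nonneg {F A B C K : ℝ → ℝ → ℝ} {R : ℝ}
    (cF : ContinuousOn (fun q : ℝ × ℝ => F q.1 q.2) (Ioo (-R) R ×ˢ univ))
    (cA : ContinuousOn (fun q : ℝ × ℝ => A q.1 q.2) (Ioo (-R) R ×ˢ univ))
    (cB : ContinuousOn (fun q : ℝ × ℝ => B q.1 q.2) (Ioo (-R) R ×ˢ univ))
    (cC : ContinuousOn (fun q : ℝ × ℝ => C q.1 q.2) (Ioo (-R) R ×ˢ univ))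
    (dF : ∀ t ∈ Ioo (-R) R, ∀ θ, HasDerivAt (fun t => F t θ) (A t θ) t)
    (dA : ∀ t ∈ Ioo (-R) R, ∀ θ, HasDerivAt (fun t => A t θ) (B t θ) t)
    (dK : ∀ t ∈ Ioo (-R) R, ∀ θ, HasDerivAt (fun θ => K t θ) (t * C t θ + -A t θ) θ)
    (hK : ∀ t, K t (2 * Real.pi) = K t 0) (hBC : ∀ t ∈ Ioo (-R) R, ∀ θ, 0 ≤ B t θ + C t θ)
    {t : ℝ} (h0 : 0 ≤ t) (ht : t < R) :
    (∫ θ in (0 : ℝ)..2 * Real.pi, F 0 θ) ≤ ∫ θ in (0 : ℝ)..2 * Real.pi, F t θ := by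
  have hslice : ∀ {g : ℝ → ℝ → ℝ}, ContinuousOn (fun q : ℝ × ℝ => g q.1 q.2) (Ioo (-R) R ×ˢ univ) →
      ∀ t ∈ Ioo (-R) R, Continuous (g t) := fun {g} hg t ht => by
    rw [← continuousOn_univ]
    exact hg.comp (f := fun θ => (t, θ)) (by fun_prop) (fun θ _ => ⟨ht, mem_univ _⟩)
  have d1 : ∀ t ∈ Ioo (-R) R, HasDerivAt (fun t => ∫ θ in (0 : ℝ)..2 * Real.pi, F t θ)
      (∫ θ in (0 : ℝ)..2 * Real.pi, A t θ) t := fun t ht =>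
    hasDerivAt_intervalIntegral_of_continuousOn isOpen_Ioo dF (hslice cF) cA ht
  have d2 : ∀ t ∈ Ioo (-R) R, HasDerivAt (fun t => ∫ θ in (0 : ℝ)..2 * Real.pi, t * A t θ)
      (∫ θ in (0 : ℝ)..2 * Real.pi, (A t θ + t * B t θ)) t := fun t ht => by
    refine hasDerivAt_intervalIntegral_of_continuousOn (s := Ioo (-R) R) isOpen_Ioo
      (F := fun t θ => t * A t θ) (F' := fun t θ => A t θ + t * B t θ)
      (fun t ht θ => ?_) (fun t ht => continuous_const.mul (hslice cA t ht))
      (cA.add (continuousOn_fst.mul cB)) ht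
    simpa using (hasDerivAt_id' t).fun_mul (dA t ht θ)
  have dθ : ∀ t ∈ Ioo (-R) R, (∫ θ in (0 : ℝ)..2 * Real.pi, (t * C t θ + -A t θ)) = 0 :=
    fun t ht => by
    rw [intervalIntegral.integral_eq_sub_of_hasDerivAt (f := fun θ => K t θ)
      (fun θ _ => dK t ht θ) (((continuous_const.mul (hslice cC t ht)).add
        (hslice cA t ht).neg).intervalIntegrable _ _), hK, sub_self]
  have hsub : Icc 0 t ⊆ Ioo (-R) R := fun x hx => ⟨by linarith [hx.1], by linarith [hx.2]⟩
  have nonneg2 : ∀ t ∈ Ioo (-R) R, 0 ≤ t →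
      0 ≤ ∫ θ in (0 : ℝ)..2 * Real.pi, (A t θ + t * B t θ) := fun t ht h0 => by
    have hi1 : IntervalIntegrable (fun θ => A t θ + t * B t θ) volume 0 (2 * Real.pi) :=
      ((hslice cA t ht).add (continuous_const.mul (hslice cB t ht))).intervalIntegrable _ _
    have hi2 : IntervalIntegrable (fun θ => t * C t θ + -A t θ) volume 0 (2 * Real.pi) :=
      ((continuous_const.mul (hslice cC t ht)).add (hslice cA t ht).neg).intervalIntegrable _ _
    have hsum := intervalIntegral.integral_add hi1 hi2
    rw [dθ t ht, add_zero] at hsum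
    rw [← hsum]
    refine intervalIntegral.integral_nonneg (by positivity) fun θ _ => ?_
    have := mul_nonneg h0 (hBC t ht θ)
    linarith
  have mono2 : MonotoneOn (fun t => ∫ θ in (0 : ℝ)..2 * Real.pi, t * A t θ) (Icc 0 t) := by
    refine monotoneOn_of_deriv_nonneg (convex_Icc 0 t)
      (fun x hx => (d2 x (hsub hx)).continuousAt.continuousWithinAt)
      (fun x hx => (d2 x (hsub (interior_subset hx))).differentiableAt.differentiableWithinAt)
      fun x hx => ?_
    rw [(d2 x (hsub (interior_subset hx))).deriv]
    exact nonneg2 x (hsub (interior_subset hx)) (interior_subset hx).1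
  have mono1 : MonotoneOn (fun t => ∫ θ in (0 : ℝ)..2 * Real.pi, F t θ) (Icc 0 t) := by
    refine monotoneOn_of_deriv_nonneg (convex_Icc 0 t)
      (fun x hx => (d1 x (hsub hx)).continuousAt.continuousWithinAt)
      (fun x hx => (d1 x (hsub (interior_subset hx))).differentiableAt.differentiableWithinAt)
      fun x hx => ?_
    rw [(d1 x (hsub (interior_subset hx))).deriv]
    rw [interior_Icc] at hx
    have := mono2 (left_mem_Icc.2 h0) (Ioo_subset_Icc_self hx) hx.1.le
    simp only [zero_mul, intervalIntegral.integral_zero, intervalIntegral.integral_const_mul] at this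
    exact nonneg_of_mul_nonneg_right this hx.1
  exact mono1 (left_mem_Icc.2 h0) (right_mem_Icc.2 h0) h0

end ParametricIntegral

section Polar

variable {E : Type*} [NormedAddCommGroup E] [NormedSpace ℂ E]

/-- A function of class `C^2` on a complex normed space is plurisubharmonic at `z` if its Levi form
at `z` is nonnegative. -/
def LeviNonneg (f : E → ℝ) (z : E) : Prop :=
  ∀ v : E, 0 ≤ fderiv ℝ (fderiv ℝ f) z v v
    + fderiv ℝ (fderiv ℝ f) z (Complex.I • v) (Complex.I • v)

/-- The point with polar coordinates `t`, `θ` on the complex line through `p` spanned by `v`. -/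
noncomputable def polarPoint (p v : E) (t θ : ℝ) : E :=
  p + ((t : ℂ) * Complex.exp (θ * Complex.I)) • v

theorem hasDerivAt_polarPoint_radius (p v : E) (t θ : ℝ) :
    HasDerivAt (fun t => polarPoint p v t θ) (Complex.exp (θ * Complex.I) • v) t := by
  have h1 : HasDerivAt (fun t : ℝ => (t : ℂ) * Complex.exp (θ * Complex.I))
      (1 * Complex.exp (θ * Complex.I)) t :=
    (Complex.ofRealCLM.hasDerivAt (x := t)).mul_const _
  simpa [polarPoint] using (h1.smul_const v).const_add p

theorem hasDerivAt_exp_angle (θ : ℝ) :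
    HasDerivAt (fun θ : ℝ => Complex.exp (θ * Complex.I))
      (Complex.I * Complex.exp (θ * Complex.I)) θ := by
  have := ((Complex.ofRealCLM.hasDerivAt (x := θ)).mul_const Complex.I).cexp
  simpa [mul_comm] using this

theorem hasDerivAt_polarPoint_angle (p v : E) (t θ : ℝ) :
    HasDerivAt (fun θ => polarPoint p v t θ)
      (t • (Complex.I • Complex.exp (θ * Complex.I) • v)) θ := by
  have := (((hasDerivAt_exp_angle θ).const_mul (t : ℂ)).smul_const v).const_add p
  rwa [← smul_smul, Complex.coe_smul, ← smul_smul] at this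

theorem continuous_polarPoint (p v : E) :
    Continuous fun q : ℝ × ℝ => polarPoint p v q.1 q.2 := by
  unfold polarPoint; fun_prop

variable {f : E → ℝ} {U : Set E} {p v : E} {R : ℝ}

theorem polarPoint_mem (hU : ∀ ζ : ℂ, ‖ζ‖ < R → p + ζ • v ∈ U) {t : ℝ} (ht : t ∈ Ioo (-R) R)
    (θ : ℝ) : polarPoint p v t θ ∈ U := by
  apply hU
  rw [norm_mul, Complex.norm_exp_ofReal_mul_I, mul_one, Complex.norm_real, Real.norm_eq_abs]
  exact abs_lt.2 ht

theorem continuousOn_comp_polarPoint {G : Type*} [TopologicalSpace G] {g : E → G}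
    (hg : ContinuousOn g U) (hU : ∀ ζ : ℂ, ‖ζ‖ < R → p + ζ • v ∈ U) :
    ContinuousOn (fun q : ℝ × ℝ => g (polarPoint p v q.1 q.2)) (Ioo (-R) R ×ˢ univ) :=
  hg.comp (continuous_polarPoint p v).continuousOn fun q hq => polarPoint_mem hU hq.1 q.2

/-- The sub-mean value inequality on a complex line. The directions `e^{iθ} v` and `i e^{iθ} v` are
the radial and angular ones, so `B + C` is the Levi form evaluated at `e^{iθ} v`. -/
theorem circleIntegral_ge_of_leviNonneg (hUo : IsOpen U) (hf : ContDiffOn ℝ 2 f U)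
    (hlevi : ∀ z ∈ U, LeviNonneg f z) (hU : ∀ ζ : ℂ, ‖ζ‖ < R → p + ζ • v ∈ U)
    {t : ℝ} (h0 : 0 ≤ t) (ht : t < R) :
    (∫ _θ in (0 : ℝ)..2 * Real.pi, f p) ≤ ∫ θ in (0 : ℝ)..2 * Real.pi, f (polarPoint p v t θ) := by
  have hfd : ContDiffOn ℝ 1 (fderiv ℝ f) U := hf.fderiv_of_isOpen hUo (by norm_num)
  have hdf : ∀ z ∈ U, HasFDerivAt f (fderiv ℝ f z) z := fun z hz =>
    ((hf.differentiableOn (by norm_num)).differentiableAt (hUo.mem_nhds hz)).hasFDerivAt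
  have hddf : ∀ z ∈ U, HasFDerivAt (fderiv ℝ f) (fderiv ℝ (fderiv ℝ f) z) z := fun z hz =>
    ((hfd.differentiableOn (by norm_num)).differentiableAt (hUo.mem_nhds hz)).hasFDerivAt
  have hcddf : ContinuousOn (fderiv ℝ (fderiv ℝ f)) U :=
    hfd.continuousOn_fderiv_of_isOpen hUo (by norm_num)
  have c0 := continuousOn_comp_polarPoint hf.continuousOn hU
  have c1 := continuousOn_comp_polarPoint hfd.continuousOn hU
  have c2 := continuousOn_comp_polarPoint hcddf hU
  have hec : ContinuousOn (fun q : ℝ × ℝ => Complex.exp (q.2 * Complex.I) • v)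
    (Ioo (-R) R ×ˢ univ) := by fun_prop
  have hiec := hec.const_smul Complex.I
  have h1 : ∀ θ : ℝ, HasDerivAt (fun θ : ℝ => Complex.I • Complex.exp (θ * Complex.I) • v)
      (-(Complex.exp (θ * Complex.I) • v)) θ := fun θ => by
    have := ((hasDerivAt_exp_angle θ).smul_const v).const_smul Complex.I
    rw [smul_smul, ← mul_assoc, Complex.I_mul_I, neg_one_mul, neg_smul] at this
    exact this
  have dt : ∀ t ∈ Ioo (-R) R, ∀ θ : ℝ, HasDerivAt (fun t => fderiv ℝ f (polarPoint p v t θ))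
      (fderiv ℝ (fderiv ℝ f) (polarPoint p v t θ) (Complex.exp (θ * Complex.I) • v)) t :=
    fun t ht θ => (hddf _ (polarPoint_mem hU ht θ)).comp_hasDerivAt t
      (hasDerivAt_polarPoint_radius p v t θ)
  have dθ : ∀ t ∈ Ioo (-R) R, ∀ θ : ℝ, HasDerivAt (fun θ => fderiv ℝ f (polarPoint p v t θ))
      (t • fderiv ℝ (fderiv ℝ f) (polarPoint p v t θ)
        (Complex.I • Complex.exp (θ * Complex.I) • v)) θ := fun t ht θ => by
    have := (hddf _ (polarPoint_mem hU ht θ)).comp_hasDerivAt θ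
      (hasDerivAt_polarPoint_angle p v t θ)
    rwa [ContinuousLinearMap.map_smul] at this
  have key := integral_zero_le_of_polar_laplacian_nonneg
    (F := fun t θ => f (polarPoint p v t θ))
    (A := fun t θ => fderiv ℝ f (polarPoint p v t θ) (Complex.exp (θ * Complex.I) • v))
    (B := fun t θ => fderiv ℝ (fderiv ℝ f) (polarPoint p v t θ) (Complex.exp (θ * Complex.I) • v)
      (Complex.exp (θ * Complex.I) • v))
    (C := fun t θ => fderiv ℝ (fderiv ℝ f) (polarPoint p v t θ)
      (Complex.I • Complex.exp (θ * Complex.I) • v) (Complex.I • Complex.exp (θ * Complex.I) • v))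
    (K := fun t θ => fderiv ℝ f (polarPoint p v t θ) (Complex.I • Complex.exp (θ * Complex.I) • v))
    c0 (c1.clm_apply hec) ((c2.clm_apply hec).clm_apply hec) ((c2.clm_apply hiec).clm_apply hiec)
    (fun t ht θ => (hdf _ (polarPoint_mem hU ht θ)).comp_hasDerivAt t
        (hasDerivAt_polarPoint_radius p v t θ))
    (fun t ht θ => by
      have := (dt t ht θ).clm_apply (hasDerivAt_const t (Complex.exp (θ * Complex.I) • v))
      rw [map_zero, add_zero] at this
      exact this)
    (fun t ht θ => by
      have := (dθ t ht θ).clm_apply (h1 θ)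
      rw [map_neg] at this
      exact this)
    (fun t => by simp [polarPoint])
    (fun t ht θ => hlevi _ (polarPoint_mem hU ht θ) _) h0 ht
  simpa [polarPoint] using key

/-- At a maximum the mean over the unit circle cannot be smaller than `f p`, while a smaller value
at the point `p + v` of that circle would make it so by continuity. -/
theorem eq_of_leviNonneg_of_le (hUo : IsOpen U) (hf : ContDiffOn ℝ 2 f U)
    (hlevi : ∀ z ∈ U, LeviNonneg f z) (hR : 1 < R) (hU : ∀ ζ : ℂ, ‖ζ‖ < R → p + ζ • v ∈ U)
    (hmax : ∀ z ∈ U, f z ≤ f p) : f (p + v) = f p := by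
  have h1 : (1 : ℝ) ∈ Ioo (-R) R := ⟨by linarith, hR⟩
  have hint := circleIntegral_ge_of_leviNonneg hUo hf hlevi hU zero_le_one hR
  have hc : Continuous fun θ => f (polarPoint p v 1 θ) := by
    rw [← continuousOn_univ]
    exact (continuousOn_comp_polarPoint hf.continuousOn hU).comp (f := fun θ => ((1 : ℝ), θ))
      (by fun_prop) (fun θ _ => ⟨h1, mem_univ _⟩)
  have hle := fun θ => hmax _ (polarPoint_mem hU h1 θ)
  by_contra hne
  have hpt : polarPoint p v 1 0 = p + v := by simp [polarPoint]
  have hlt : f (polarPoint p v 1 0) < f p := lt_of_le_of_ne (hle 0) (by rwa [hpt])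
  have hpos : 0 < ∫ θ in (0 : ℝ)..2 * Real.pi, (f p - f (polarPoint p v 1 θ)) :=
    intervalIntegral.integral_pos Real.two_pi_pos (continuous_const.sub hc).continuousOn
      (fun θ _ => sub_nonneg.2 (hle θ)) ⟨0, left_mem_Icc.2 Real.two_pi_pos.le, sub_pos.2 hlt⟩
  rw [intervalIntegral.integral_sub intervalIntegrable_const (hc.intervalIntegrable _ _)] at hpos
  linarith

end Polar

section Manifold

variable {E : Type*} [NormedAddCommGroup E] [NormedSpace ℂ E]
  {N : Type*} [TopologicalSpace N] [ChartedSpace E N] [CompactSpace N] [ConnectedSpace N]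

/-- The maximum principle: on a compact connected complex manifold, a function which is
plurisubharmonic in all coordinate charts is constant. -/
theorem eq_of_leviNonneg_of_compact {f : N → ℝ}
    (hf : ∀ c : N, ContDiffOn ℝ 2 (f ∘ (extChartAt 𝓘(ℂ, E) c).symm) (extChartAt 𝓘(ℂ, E) c).target)
    (hlevi : ∀ c : N, ∀ z ∈ (extChartAt 𝓘(ℂ, E) c).target,
      LeviNonneg (f ∘ (extChartAt 𝓘(ℂ, E) c).symm) z) (x y : N) : f x = f y := by
  have hfc : Continuous f := by
    rw [continuous_iff_continuousAt]
    intro c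
    have h1 : ContinuousAt (f ∘ (extChartAt 𝓘(ℂ, E) c).symm) (extChartAt 𝓘(ℂ, E) c c) :=
      (hf c).continuousOn.continuousAt (extChartAt_target_mem_nhds c)
    have h2 := h1.comp (continuousAt_extChartAt (I := 𝓘(ℂ, E)) c)
    refine h2.congr ?_
    filter_upwards [extChartAt_source_mem_nhds (I := 𝓘(ℂ, E)) c] with q hq
    rw [Function.comp_apply, Function.comp_apply, (extChartAt 𝓘(ℂ, E) c).left_inv hq]
  obtain ⟨m, -, hm⟩ := isCompact_univ.exists_isMaxOn (univ_nonempty (α := N)) hfc.continuousOn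
  have hm' : ∀ q, f q ≤ f m := fun q => hm (mem_univ q)
  suffices h : {q | f q = f m} = univ by
    have hx : x ∈ {q | f q = f m} := h ▸ mem_univ x
    have hy : y ∈ {q | f q = f m} := h ▸ mem_univ y
    exact hx.trans hy.symm
  -- The set of maximum points is closed and nonempty; the local statement along complex lines
  -- through a maximum point shows that it is open.
  refine IsClopen.eq_univ ⟨isClosed_eq hfc continuous_const, ?_⟩ ⟨m, rfl⟩
  rw [isOpen_iff_mem_nhds]
  intro c (hc : f c = f m)
  obtain ⟨ε, hε, hball⟩ := Metric.isOpen_iff.1 (isOpen_extChartAt_target (I := 𝓘(ℂ, E)) c) _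
    (mem_extChartAt_target c)
  have hnb := (continuousAt_extChartAt (I := 𝓘(ℂ, E)) c).preimage_mem_nhds
    (ball_mem_nhds _ (half_pos hε))
  filter_upwards [hnb, extChartAt_source_mem_nhds (I := 𝓘(ℂ, E)) c] with q hq hqs
  set p := extChartAt 𝓘(ℂ, E) c c
  set g := f ∘ (extChartAt 𝓘(ℂ, E) c).symm with hg
  have hgp : g p = f c := by simp [hg, p]
  have key : g (p + (extChartAt 𝓘(ℂ, E) c q - p)) = g p := by
    -- The displacement is shorter than `ε / 2`, so its multiples by `‖ζ‖ < 2` stay in the ball of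
    -- radius `ε`.
    refine eq_of_leviNonneg_of_le (R := 2) (U := (extChartAt 𝓘(ℂ, E) c).target)
      (isOpen_extChartAt_target c) (hf c) (hlevi c) (by norm_num) (fun ζ hζ => hball ?_)
      (fun z _ => ?_)
    · rw [mem_ball, dist_eq_norm, add_sub_cancel_left, norm_smul]
      have : ‖extChartAt 𝓘(ℂ, E) c q - p‖ < ε / 2 := by
        rw [← dist_eq_norm]; exact hq
      nlinarith [norm_nonneg ζ, norm_nonneg (extChartAt 𝓘(ℂ, E) c q - p)]
    · rw [hgp, hc]; exact hm' _
  rw [add_sub_cancel, hgp, hc] at key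
  rwa [hg, Function.comp_apply, (extChartAt 𝓘(ℂ, E) c).left_inv hqs] at key

end Manifold

end MaximumPrinciple

/-! ### Calculus of the Wirtinger derivatives -/

section Wirtinger

variable {E F G : Type*} [NormedAddCommGroup E] [NormedSpace ℂ E]
  [NormedAddCommGroup F] [NormedSpace ℂ F] [NormedAddCommGroup G] [NormedSpace ℂ G]

theorem fderiv_clm_comp_apply (L : F →L[ℂ] G) {f : E → F} {z : E} (hf : DifferentiableAt ℝ f z)
    (v : E) : fderiv ℝ (fun z => L (f z)) z v = L (fderiv ℝ f z v) := by
  have := (L.restrictScalars ℝ).hasFDerivAt.comp z hf.hasFDerivAt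
  have h2 : fderiv ℝ (fun z => L (f z)) z = (L.restrictScalars ℝ).comp (fderiv ℝ f z) := this.fderiv
  rw [h2]; rfl

theorem _root_.ContinuousLinearMap.comp_differentiableAt_real (L : F →L[ℂ] G) {f : E → F} {z : E}
    (hf : DifferentiableAt ℝ f z) : DifferentiableAt ℝ (fun z => L (f z)) z :=
  (L.restrictScalars ℝ).differentiableAt.comp z hf

theorem _root_.ContinuousLinearMap.comp_contDiffAt_real (L : F →L[ℂ] G) {f : E → F} {z : E}
    {n : WithTop ℕ∞} (hf : ContDiffAt ℝ n f z) : ContDiffAt ℝ n (fun z => L (f z)) z :=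
  (L.restrictScalars ℝ).contDiff.contDiffAt.comp z hf

theorem del_clm_comp (L : F →L[ℂ] G) {f : E → F} {z : E} (hf : DifferentiableAt ℝ f z) (v : E) :
    del v (fun z => L (f z)) z = L (del v f z) := by
  simp only [del, fderiv_clm_comp_apply L hf, map_smul, map_sub]

theorem delBar_clm_comp (L : F →L[ℂ] G) {f : E → F} {z : E} (hf : DifferentiableAt ℝ f z) (v : E) :
    delBar v (fun z => L (f z)) z = L (delBar v f z) := by
  simp only [delBar, fderiv_clm_comp_apply L hf, map_smul, map_add]

theorem delBar_conj {f : E → ℂ} {z : E} (hf : DifferentiableAt ℝ f z) (v : E) :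
    delBar v (fun z => conj (f z)) z = conj (del v f z) := by
  have h : ∀ v, fderiv ℝ (fun z => conj (f z)) z v = conj (fderiv ℝ f z v) := fun v => by
    have := (Complex.conjCLE.toContinuousLinearMap.hasFDerivAt (x := f z)).comp z hf.hasFDerivAt
    have h2 : fderiv ℝ (fun z => conj (f z)) z
      = Complex.conjCLE.toContinuousLinearMap.comp (fderiv ℝ f z) := this.fderiv
    rw [h2]; rfl
  simp only [delBar, del, h, smul_eq_mul, map_mul, map_sub, map_div₀, map_one, map_ofNat,
    Complex.conj_I]
  ring

theorem _root_.Filter.EventuallyEq.del_eq {f g : E → F} {z : E} (h : f =ᶠ[𝓝 z] g) (v : E) :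
    del v f z = del v g z := by
  simp only [del, h.fderiv_eq]

theorem _root_.Filter.EventuallyEq.delBar_eq {f g : E → F} {z : E} (h : f =ᶠ[𝓝 z] g) (v : E) :
    delBar v f z = delBar v g z := by
  simp only [delBar, h.fderiv_eq]

theorem del_zero_left (f : E → F) (z : E) : del 0 f z = 0 := by simp [del]

theorem _root_.ContDiffAt.differentiableAt_delBar {f : E → F} {z : E} (hf : ContDiffAt ℝ 2 f z)
    (v : E) : DifferentiableAt ℝ (delBar v f) z := by
  have h : DifferentiableAt ℝ (fderiv ℝ f) z :=
    (hf.fderiv_right (m := 1) (by norm_num)).differentiableAt (by norm_num)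
  unfold delBar
  exact ((h.clm_apply (differentiableAt_const v)).add
    ((h.clm_apply (differentiableAt_const (Complex.I • v))).const_smul Complex.I)).const_smul _

theorem del_delBar_clm_comp (L : F →L[ℂ] G) {f : E → F} {z : E} (hf : ContDiffAt ℝ 2 f z)
    (v t : E) : del v (delBar t (fun z => L (f z))) z = L (del v (delBar t f) z) := by
  rw [← del_clm_comp L (hf.differentiableAt_delBar t)]
  refine Filter.EventuallyEq.del_eq ?_ v
  filter_upwards [hf.eventually (by simp)] with y hy
  exact delBar_clm_comp L (hy.differentiableAt (by norm_num)) t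

/-- The mixed second Wirtinger derivative of `f` in the direction `v` is a quarter of the Levi form. -/
theorem del_delBar_re {f : E → ℂ} {z : E} (hf : ContDiffAt ℝ 2 f z) (v : E) :
    4 * (del v (delBar v f) z).re =
      fderiv ℝ (fderiv ℝ fun z => (f z).re) z v v
        + fderiv ℝ (fderiv ℝ fun z => (f z).re) z (Complex.I • v) (Complex.I • v) := by
  have h : DifferentiableAt ℝ (fderiv ℝ f) z :=
    (hf.fderiv_right (m := 1) (by norm_num)).differentiableAt (by norm_num)
  have hre : ∀ a b : E, fderiv ℝ (fderiv ℝ fun z => (f z).re) z a b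
      = (fderiv ℝ (fderiv ℝ f) z a b).re := fun a b => by
    have h1 : (fderiv ℝ fun z => (f z).re) =ᶠ[𝓝 z] fun y => Complex.reCLM.comp (fderiv ℝ f y) := by
      filter_upwards [hf.eventually (by simp)] with y hy
      exact (Complex.reCLM.hasFDerivAt.comp y
        (hy.differentiableAt (by norm_num)).hasFDerivAt).fderiv
    rw [h1.fderiv_eq]
    have h2 := (ContinuousLinearMap.compL ℝ E ℂ ℝ Complex.reCLM).hasFDerivAt.comp z h.hasFDerivAt
    have h3 : fderiv ℝ (fun y => Complex.reCLM.comp (fderiv ℝ f y)) z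
      = (ContinuousLinearMap.compL ℝ E ℂ ℝ Complex.reCLM).comp (fderiv ℝ (fderiv ℝ f) z) := h2.fderiv
    rw [h3]; rfl
  have hap : ∀ a b : E, fderiv ℝ (delBar b f) z a = (1 / 2 : ℂ) • (fderiv ℝ (fderiv ℝ f) z a b
      + Complex.I • fderiv ℝ (fderiv ℝ f) z a (Complex.I • b)) := fun a b => by
    have h1 : ∀ b : E, HasFDerivAt (fun y => fderiv ℝ f y b)
        ((fderiv ℝ (fderiv ℝ f) z).flip b) z := fun b => by
      have := h.hasFDerivAt.clm_apply (hasFDerivAt_const b z)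
      simpa using this
    have h2 : HasFDerivAt (delBar b f) _ z :=
      ((h1 b).add ((h1 (Complex.I • b)).const_smul Complex.I)).const_smul (1 / 2 : ℂ)
    rw [h2.fderiv]; rfl
  -- The expansion of `∂_v ∂̄_v f` contains `D²f(v, iv)` and `D²f(iv, v)` with opposite factors `± i
  -- / 4`; symmetry cancels them.
  have hsymm : fderiv ℝ (fderiv ℝ f) z (Complex.I • v) v
      = fderiv ℝ (fderiv ℝ f) z v (Complex.I • v) :=
    (hf.isSymmSndFDerivAt (by simp)) _ _
  rw [hre, hre, ← Complex.add_re]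
  simp only [del, hap, hsymm, smul_eq_mul]
  rw [← Complex.re_ofReal_mul]
  congr 1
  push_cast
  linear_combination (-(fderiv ℝ (fderiv ℝ f) z (Complex.I • v)) (Complex.I • v)) * Complex.I_sq

theorem fderiv_comp_affine {E' : Type*} [NormedAddCommGroup E'] [NormedSpace ℂ E']
    (j : E' →L[ℂ] E) (b : E) {f : E → F} {w : E'} (hf : DifferentiableAt ℝ f (b + j w)) (v : E') :
    fderiv ℝ (fun w => f (b + j w)) w v = fderiv ℝ f (b + j w) (j v) := by
  have h1 : HasFDerivAt (fun w => b + j w) (j.restrictScalars ℝ) w :=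
    (j.restrictScalars ℝ).hasFDerivAt.const_add b
  have h2 := hf.hasFDerivAt.comp w h1
  have h3 : fderiv ℝ (fun w => f (b + j w)) w
    = (fderiv ℝ f (b + j w)).comp (j.restrictScalars ℝ) := h2.fderiv
  rw [h3]; rfl

theorem del_comp_affine {E' : Type*} [NormedAddCommGroup E'] [NormedSpace ℂ E']
    (j : E' →L[ℂ] E) (b : E) {f : E → F} {w : E'} (hf : DifferentiableAt ℝ f (b + j w)) (v : E') :
    del v (fun w => f (b + j w)) w = del (j v) f (b + j w) := by
  simp only [del, fderiv_comp_affine j b hf, map_smul]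

theorem delBar_comp_affine {E' : Type*} [NormedAddCommGroup E'] [NormedSpace ℂ E']
    (j : E' →L[ℂ] E) (b : E) {f : E → F} {w : E'} (hf : DifferentiableAt ℝ f (b + j w)) (v : E') :
    delBar v (fun w => f (b + j w)) w = delBar (j v) f (b + j w) := by
  simp only [delBar, fderiv_comp_affine j b hf, map_smul]

theorem del_delBar_comp_affine {E' : Type*} [NormedAddCommGroup E'] [NormedSpace ℂ E']
    (j : E' →L[ℂ] E) (b : E) {f : E → F} {w : E'} (hf : ContDiffAt ℝ 2 f (b + j w)) (v t : E') :
    del v (delBar t (fun w => f (b + j w))) w = del (j v) (delBar (j t) f) (b + j w) := by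
  rw [← del_comp_affine j b (hf.differentiableAt_delBar (j t))]
  refine Filter.EventuallyEq.del_eq ?_ v
  have hc : ContinuousAt (fun w => b + j w) w := by fun_prop
  filter_upwards [hc.eventually (hf.eventually (by simp))] with y hy
  exact delBar_comp_affine j b (hy.differentiableAt (by norm_num)) t

/-- A real-differentiable function that is killed by the `(0,1)`-derivatives is
complex-differentiable. -/
theorem differentiableAt_of_delBar_eq_zero {f : E → F} {z : E} (hf : DifferentiableAt ℝ f z)
    (h : ∀ v, delBar v f z = 0) : DifferentiableAt ℂ f z := by
  have hI : ∀ v, fderiv ℝ f z (Complex.I • v) = Complex.I • fderiv ℝ f z v := fun v => by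
    have := h v
    rw [delBar, smul_eq_zero_iff_right (by norm_num)] at this
    have h2 := congrArg (fun x => Complex.I • x) this
    simp only [smul_add, smul_smul, Complex.I_mul_I, smul_zero, neg_smul, one_smul] at h2
    rw [add_neg_eq_zero] at h2
    exact h2.symm
  have hlin : ∀ (c : ℂ) (v : E), fderiv ℝ f z (c • v) = c • fderiv ℝ f z v := fun c v => by
    have hc : ∀ x : E, c • x = c.re • x + c.im • (Complex.I • x) := fun x => by
      rw [← Complex.coe_smul c.re, ← Complex.coe_smul c.im, smul_smul, ← add_smul, Complex.re_add_im]
    have hc' : ∀ x : F, c • x = c.re • x + c.im • (Complex.I • x) := fun x => by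
      rw [← Complex.coe_smul c.re, ← Complex.coe_smul c.im, smul_smul, ← add_smul, Complex.re_add_im]
    rw [hc v, hc' (fderiv ℝ f z v), map_add, ContinuousLinearMap.map_smul,
      ContinuousLinearMap.map_smul, hI]
  rw [differentiableAt_iff_restrictScalars ℝ hf]
  exact ⟨{ toLinearMap := { toFun := fderiv ℝ f z, map_add' := map_add _, map_smul' := hlin }
           cont := (fderiv ℝ f z).cont }, by ext; rfl⟩

end Wirtinger

/-! ### Invertibility of positive sesquilinear forms -/

section Sesquilinear

variable {E : Type*} [NormedAddCommGroup E] [NormedSpace ℂ E]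

/-- The evaluation of sesquilinear forms at a pair of vectors. -/
noncomputable def evalSesq (u w : E) : (E →L[ℂ] E →L⋆[ℂ] ℂ) →L[ℂ] ℂ :=
  (ContinuousLinearMap.apply' ℂ (starRingEnd ℂ) w).comp
    (ContinuousLinearMap.apply ℂ (E →L⋆[ℂ] ℂ) u)

/-- Positivity gives injectivity, and surjectivity follows by counting dimensions. Conjugating the
values replaces the conjugate-linear dual by the ordinary one, whose dimension is known; the
resulting map `T` is only real-linear, so the count is over `ℝ`. -/
theorem isInvertible_of_pos [FiniteDimensional ℂ E] {B : E →L[ℂ] E →L⋆[ℂ] ℂ}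
    (hB : ∀ u, u ≠ 0 → 0 < (B u u).re) : B.IsInvertible := by
  have hinj : ∀ u, (∀ w, B u w = 0) → u = 0 := fun u hu => by
    by_contra hne
    have := hB u hne
    rw [hu u] at this
    simp at this
  let T : E →ₗ[ℝ] (E →ₗ[ℂ] ℂ) :=
    { toFun := fun u =>
        { toFun := fun w => conj (B u w)
          map_add' := fun x y => by simp
          map_smul' := fun c x => by simp }
      map_add' := fun x y => by ext w; simp
      map_smul' := fun c x => by
        ext w
        change conj (B (c • x) w) = c • conj (B x w)
        rw [← Complex.coe_smul c x, map_smul]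
        simp }
  have hTinj : Function.Injective T := by
    rw [injective_iff_map_eq_zero]
    intro u hu
    refine hinj u fun w => ?_
    have : conj (B u w) = 0 := congrArg (fun f : E →ₗ[ℂ] ℂ => f w) hu
    simpa using this
  have hfin : FiniteDimensional ℝ E := FiniteDimensional.complexToReal E
  have hfin' : FiniteDimensional ℝ (E →ₗ[ℂ] ℂ) := FiniteDimensional.complexToReal _
  have hrank : Module.finrank ℝ E = Module.finrank ℝ (E →ₗ[ℂ] ℂ) := by
    rw [finrank_real_of_complex, finrank_real_of_complex]
    congr 1
    exact (Subspace.dual_finrank_eq (K := ℂ) (V := E)).symm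
  have hTsurj : Function.Surjective T :=
    (LinearMap.injective_iff_surjective_of_finrank_eq_finrank hrank).1 hTinj
  have : CompleteSpace E := FiniteDimensional.complete ℂ E
  refine ⟨ContinuousLinearEquiv.ofBijective B ?_ ?_, ContinuousLinearEquiv.coe_ofBijective B _ _⟩
  · refine LinearMap.ker_eq_bot'.2 fun u hu => hinj u fun w => ?_
    have := congrArg (fun f : E →L⋆[ℂ] ℂ => f w) hu
    exact this
  · refine LinearMap.range_eq_top.2 fun ℓ => ?_
    obtain ⟨u, hu⟩ := hTsurj
      { toFun := fun w => conj (ℓ w)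
        map_add' := fun x y => by simp
        map_smul' := fun c x => by simp }
    refine ⟨u, ?_⟩
    ext w
    have := congrArg (fun f : E →ₗ[ℂ] ℂ => f w) hu
    exact (starRingEnd ℂ).injective this

end Sesquilinear

/-! ### Curvature inequalities and restriction to slices -/

namespace HermitianMetric

variable {E : Type*} [NormedAddCommGroup E] [NormedSpace ℂ E] {H : Type*} [TopologicalSpace H]
  {I : ModelWithCorners ℂ E H} {M : Type*} [TopologicalSpace M] [ChartedSpace H M]
  (h : HermitianMetric I M)

theorem coord_conj (c : M) (z u v : E) : conj (h.coord c z u v) = h.coord c z v u :=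
  h.conj_symm ((extChartAt I c).symm z) (coordFrame I c z u) (coordFrame I c z v)

variable [I.Boundaryless]

theorem coordFrame_isInvertible [IsManifold I 1 M] {c : M} {z : E}
    (hz : z ∈ (extChartAt I c).target) : (coordFrame I c z).IsInvertible := by
  have := isInvertible_mfderivWithin_extChartAt_symm hz
  rwa [I.range_eq_univ, mfderivWithin_univ] at this

theorem coord_pos [IsManifold I 1 M] {c : M} {z : E} (hz : z ∈ (extChartAt I c).target) {u : E}
    (hu : u ≠ 0) : 0 < (h.coord c z u u).re := by
  refine h.pos _ _ fun h0 => hu ?_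
  obtain ⟨A, hA⟩ := coordFrame_isInvertible (I := I) hz
  rw [← hA] at h0
  exact A.injective (h0.trans (map_zero A).symm)

theorem coord_self_nonneg [IsManifold I 1 M] {c : M} {z : E} (hz : z ∈ (extChartAt I c).target)
    (u : E) : 0 ≤ (h.coord c z u u).re := by
  rcases eq_or_ne u 0 with rfl | hu
  · simp
  · exact (h.coord_pos hz hu).le

theorem contDiffAt_coord {c : M} {z : E} (hz : z ∈ (extChartAt I c).target) :
    @ContDiffAt ℝ _ E _ _ (E →L[ℂ] E →L⋆[ℂ] ℂ) _ NormedSpace.complexToReal 2 (h.coord c) z :=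
  ((h.smooth c).contDiffAt ((isOpen_extChartAt_target c).mem_nhds hz)).of_le ENat.LEInfty.out

theorem differentiableAt_coord {c : M} {z : E} (hz : z ∈ (extChartAt I c).target) :
    @DifferentiableAt ℝ _ E _ _ _ (E →L[ℂ] E →L⋆[ℂ] ℂ) _ NormedSpace.complexToReal.toModule _
      (h.coord c) z :=
  (h.contDiffAt_coord hz).differentiableAt (by norm_num)

theorem delBar_coord_apply {c : M} {z : E} (hz : z ∈ (extChartAt I c).target) (v a u : E) :
    delBar v (h.coord c) z a u = conj (del v (h.coord c) z u a) := by
  have h1 := delBar_clm_comp (evalSesq a u) (f := h.coord c) (h.differentiableAt_coord hz) v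
  have h2 := del_clm_comp (evalSesq u a) (f := h.coord c) (h.differentiableAt_coord hz) v
  have hd : DifferentiableAt ℝ (fun z => evalSesq u a (h.coord c z)) z :=
    (evalSesq u a).comp_differentiableAt_real (f := h.coord c) (h.differentiableAt_coord hz)
  have h3 := delBar_conj hd v
  rw [h2] at h3
  have h4 : (fun z => conj (evalSesq u a (h.coord c z))) = fun z => evalSesq a u (h.coord c z) :=
    funext fun z => h.coord_conj c z u a
  rw [h4, h1] at h3
  exact h3

variable [IsManifold I 1 M] [FiniteDimensional ℂ E]

/-- The vector dual to the derivative `∂_v h(u, ·)` with respect to `h`. -/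
noncomputable def connectionVector (c : M) (z v u : E) : E :=
  (h.coord c z).inverse (del v (h.coord c) z u)

theorem coord_connectionVector {c : M} {z : E} (hz : z ∈ (extChartAt I c).target) (v u : E) :
    h.coord c z (h.connectionVector c z v u) = del v (h.coord c) z u :=
  (isInvertible_of_pos fun _ hu => h.coord_pos hz hu).self_apply_inverse _

/-- If `h(a, ·) = ∂_v h(u, ·)`, then `∂̄_v h(a, u)` is the conjugate of `∂_v h(u, a) = h(a, a)`. The
quadratic term of the curvature is therefore the squared norm of `a`. -/
theorem chernCurvature_self_re {c : M} {z : E} (hz : z ∈ (extChartAt I c).target) (u v : E) :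
    (h.chernCurvature c z u u v v).re = -(del v (delBar v (h.coord c)) z u u).re
      + (h.coord c z (h.connectionVector c z v u) (h.connectionVector c z v u)).re := by
  have h1 : delBar v (h.coord c) z (h.connectionVector c z v u) u
      = h.coord c z (h.connectionVector c z v u) (h.connectionVector c z v u) := by
    rw [h.delBar_coord_apply hz, ← h.coord_connectionVector hz, h.coord_conj]
  rw [← h1]
  rfl

variable {h} in
theorem NonposBisectionalCurvature.le_del_delBar (hh : h.NonposBisectionalCurvature) {c : M} {z : E}
    (hz : z ∈ (extChartAt I c).target) {u v : E} (hu : u ≠ 0) (hv : v ≠ 0) :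
    (h.coord c z (h.connectionVector c z v u) (h.connectionVector c z v u)).re
      ≤ (del v (delBar v (h.coord c)) z u u).re := by
  have h1 := hh c z hz u v hu hv
  rw [bisectionalCurvature, h.chernCurvature_self_re hz] at h1
  have h2 := mul_pos (h.coord_pos hz hu) (h.coord_pos hz hv)
  rw [div_le_iff₀ h2, zero_mul] at h1
  linarith

theorem nonposBisectionalCurvature_of_le
    (hle : ∀ (c : M), ∀ z ∈ (extChartAt I c).target, ∀ u v : E, u ≠ 0 → v ≠ 0 →
      (h.coord c z (h.connectionVector c z v u) (h.connectionVector c z v u)).re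
        ≤ (del v (delBar v (h.coord c)) z u u).re) : h.NonposBisectionalCurvature := by
  intro c z hz u v hu hv
  rw [bisectionalCurvature, h.chernCurvature_self_re hz]
  have h2 := mul_pos (h.coord_pos hz hu) (h.coord_pos hz hv)
  rw [div_le_iff₀ h2, zero_mul]
  linarith [hle c z hz u v hu hv]

section Slice

variable {E' : Type*} [NormedAddCommGroup E'] [NormedSpace ℂ E']
  {N : Type*} [TopologicalSpace N] [ChartedSpace E' N]

variable {h} in
-- The rigidity at the heart of the proof, for a family of affine slices `w ↦ b c + j w` so that it
-- serves both factors. The Levi form of `f` is `4 Re ∂∂̄ h(u, u)`, bounded below by four times the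
-- squared norm of the connection vector. The maximum principle makes `f` constant, so that norm is
-- zero, and with the connection vector its dual form `∂ h(u, ·)` vanishes too.
theorem NonposBisectionalCurvature.eq_const_and_del_eq_zero [CompactSpace N] [ConnectedSpace N]
    (hh : h.NonposBisectionalCurvature) (j : E' →L[ℂ] E) (hj : Function.Injective j)
    (C : N → M) (b : N → E) (u : N → E) (hu : ∀ c, u c ≠ 0) (f : N → ℝ)
    (hC : ∀ c : N, ∀ w ∈ (extChartAt 𝓘(ℂ, E') c).target, b c + j w ∈ (extChartAt I (C c)).target)
    (hf : ∀ c : N, ∀ w ∈ (extChartAt 𝓘(ℂ, E') c).target,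
      f ((extChartAt 𝓘(ℂ, E') c).symm w) = (h.coord (C c) (b c + j w) (u c) (u c)).re) :
    (∀ x y, f x = f y) ∧ ∀ c : N, ∀ w ∈ (extChartAt 𝓘(ℂ, E') c).target, ∀ v : E',
      del (j v) (h.coord (C c)) (b c + j w) (u c) = 0 := by
  set F : N → E' → ℂ := fun c w => evalSesq (u c) (u c) (h.coord (C c) (b c + j w)) with hF
  have hcomp : ∀ c : N, ∀ w ∈ (extChartAt 𝓘(ℂ, E') c).target,
      ContDiffAt ℝ 2 (fun z => evalSesq (u c) (u c) (h.coord (C c) z)) (b c + j w) := fun c w hw =>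
    (evalSesq (u c) (u c)).comp_contDiffAt_real (h.contDiffAt_coord (hC c w hw))
  have hFd : ∀ c : N, ∀ w ∈ (extChartAt 𝓘(ℂ, E') c).target, ContDiffAt ℝ 2 (F c) w :=
    fun c w hw => (hcomp c w hw).comp (f := fun w => b c + j w) w
      (contDiff_const.add (j.restrictScalars ℝ).contDiff).contDiffAt
  have heq : ∀ c : N, ∀ w ∈ (extChartAt 𝓘(ℂ, E') c).target,
      (f ∘ (extChartAt 𝓘(ℂ, E') c).symm) =ᶠ[𝓝 w] fun w => (F c w).re := fun c w hw => by
    filter_upwards [(isOpen_extChartAt_target c).mem_nhds hw] with y hy using hf c y hy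
  have hdd : ∀ c : N, ∀ w ∈ (extChartAt 𝓘(ℂ, E') c).target, ∀ v : E',
      4 * (del (j v) (delBar (j v) (h.coord (C c))) (b c + j w) (u c) (u c)).re =
        fderiv ℝ (fderiv ℝ (f ∘ (extChartAt 𝓘(ℂ, E') c).symm)) w v v
        + fderiv ℝ (fderiv ℝ (f ∘ (extChartAt 𝓘(ℂ, E') c).symm)) w
            (Complex.I • v) (Complex.I • v) := fun c w hw v => by
    rw [(heq c w hw).fderiv.fderiv_eq, ← del_delBar_re (hFd c w hw) v]
    congr 2
    have h1 := del_delBar_comp_affine j (b c) (hcomp c w hw) v v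
    rw [del_delBar_clm_comp (evalSesq (u c) (u c)) (f := h.coord (C c)) (h.contDiffAt_coord (hC c w hw))] at h1
    exact h1.symm
  have hconst : ∀ x y, f x = f y := by
    refine eq_of_leviNonneg_of_compact (E := E') (fun c w hw => ?_) fun c w hw v => ?_
    · exact ((Complex.reCLM.contDiff.contDiffAt.comp w (hFd c w hw)).congr_of_eventuallyEq
        (heq c w hw)).contDiffWithinAt
    · rw [← hdd c w hw v]
      rcases eq_or_ne v 0 with rfl | hv
      · simp [del_zero_left]
      · have := hh.le_del_delBar (hC c w hw) (hu c) ((map_ne_zero_iff j hj).2 hv)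
        have := h.coord_self_nonneg (hC c w hw) (h.connectionVector (C c) (b c + j w) (j v) (u c))
        linarith
  refine ⟨hconst, fun c w hw v => ?_⟩
  rcases eq_or_ne v 0 with rfl | hv
  · simp [del_zero_left]
  have h0 : (f ∘ (extChartAt 𝓘(ℂ, E') c).symm) = fun _ => f c := funext fun _ => hconst _ _
  have h1 := hdd c w hw v
  rw [h0] at h1
  have h2 : (del (j v) (delBar (j v) (h.coord (C c))) (b c + j w) (u c) (u c)).re = 0 := by
    simpa using h1
  have h3 := hh.le_del_delBar (hC c w hw) (hu c) ((map_ne_zero_iff j hj).2 hv)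
  rw [← h.coord_connectionVector (hC c w hw)]
  by_cases h4 : h.connectionVector (C c) (b c + j w) (j v) (u c) = 0
  · rw [h4, map_zero]
  · have := h.coord_pos (hC c w hw) h4
    linarith

variable {h} in
/-- The Griffiths inequality: the bisectional curvature decreases in holomorphic subspaces. -/
theorem NonposBisectionalCurvature.of_slice [IsManifold 𝓘(ℂ, E') 1 N] [FiniteDimensional ℂ E']
    (hh : h.NonposBisectionalCurvature) (k : HermitianMetric 𝓘(ℂ, E') N)
    (j : E' →L[ℂ] E) (hj : Function.Injective j) (C : N → M) (b : N → E)
    (hC : ∀ c : N, ∀ w ∈ (extChartAt 𝓘(ℂ, E') c).target, b c + j w ∈ (extChartAt I (C c)).target)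
    (hk : ∀ c : N, ∀ w ∈ (extChartAt 𝓘(ℂ, E') c).target, ∀ u u' : E',
      k.coord c w u u' = h.coord (C c) (b c + j w) (j u) (j u')) :
    k.NonposBisectionalCurvature := by
  refine k.nonposBisectionalCurvature_of_le fun c w hw u v hu hv => ?_
  have hw' := hC c w hw
  have hju := (map_ne_zero_iff j hj).2 hu
  have hjv := (map_ne_zero_iff j hj).2 hv
  have heq : ∀ u u' : E', (fun w => evalSesq u u' (k.coord c w)) =ᶠ[𝓝 w]
      fun w => evalSesq (j u) (j u') (h.coord (C c) (b c + j w)) := fun u u' => by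
    filter_upwards [(isOpen_extChartAt_target c).mem_nhds hw] with y hy using hk c y hy u u'
  have hcomp : ∀ u u' : E,
      ContDiffAt ℝ 2 (fun z => evalSesq u u' (h.coord (C c) z)) (b c + j w) := fun u u' =>
    (evalSesq u u').comp_contDiffAt_real (h.contDiffAt_coord hw')
  have hdel : ∀ u' : E', del v (k.coord c) w u u'
      = del (j v) (h.coord (C c)) (b c + j w) (j u) (j u') := fun u' => by
    have h1 := (heq u u').del_eq v
    rw [del_clm_comp (evalSesq u u') (f := k.coord c) (k.differentiableAt_coord hw),
      del_comp_affine j (b c) (f := fun z => evalSesq (j u) (j u') (h.coord (C c) z)) ((hcomp _ _).differentiableAt (by norm_num)) v,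
      del_clm_comp (evalSesq (j u) (j u')) (f := h.coord (C c)) (h.differentiableAt_coord hw')] at h1
    exact h1
  have hdd : del v (delBar v (k.coord c)) w u u
      = del (j v) (delBar (j v) (h.coord (C c))) (b c + j w) (j u) (j u) := by
    have h1 : (delBar v fun w => evalSesq u u (k.coord c w)) =ᶠ[𝓝 w]
        delBar v fun w => evalSesq (j u) (j u) (h.coord (C c) (b c + j w)) := by
      filter_upwards [(heq u u).eventually_nhds] with y hy using Filter.EventuallyEq.delBar_eq hy v
    have h2 := h1.del_eq v
    rw [del_delBar_clm_comp (evalSesq u u) (f := k.coord c) (k.contDiffAt_coord hw), 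
      del_delBar_comp_affine j (b c) (f := fun z => evalSesq (j u) (j u) (h.coord (C c) z))
        (hcomp _ _),
      del_delBar_clm_comp (evalSesq (j u) (j u)) (f := h.coord (C c)) (h.contDiffAt_coord hw')] at h2
    exact h2
  rw [hdd]
  refine le_trans ?_ (hh.le_del_delBar hw' hju hjv)
  set a := h.connectionVector (C c) (b c + j w) (j v) (j u) with ha
  set a₁ := k.connectionVector c w v u with ha₁
  have e1 : k.coord c w a₁ a₁ = h.coord (C c) (b c + j w) a (j a₁) := by
    rw [k.coord_connectionVector hw, hdel, h.coord_connectionVector hw']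
  have e2 : h.coord (C c) (b c + j w) (j a₁) (j a₁) = k.coord c w a₁ a₁ := (hk c w hw _ _).symm
  have e3 : (h.coord (C c) (b c + j w) (j a₁) a).re = (h.coord (C c) (b c + j w) a (j a₁)).re := by
    rw [← h.coord_conj, Complex.conj_re]
  -- The vector `j a₁` is the orthogonal projection of `a` to the image of `j`, because both
  -- represent the same derivative there. Expanding `|a - j a₁|² ≥ 0` gives `|a₁|² ≤ |a|²`.
  have hpos := h.coord_self_nonneg hw' (a - j a₁)
  simp only [map_sub, sub_apply, Complex.sub_re, e3, e2, ← e1] at hpos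
  linarith

end Slice

end HermitianMetric

/-! ### Functions of two variables with separately finite expansions -/

section LinearAlgebra

/-- The vectors `(ψ l q)_l` span `ι → ℂ`: a nonzero functional vanishing on all of them would be a
linear relation between the `ψ l`. Each `m l` writes a standard basis vector in terms of them, and
so acts as a dual functional made of point evaluations. -/
theorem exists_dual_combination {Q ι : Type*} [Fintype ι] [DecidableEq ι] {ψ : ι → Q → ℂ}
    (hψ : LinearIndependent ℂ ψ) :
    ∃ m : ι → Q →₀ ℂ, ∀ l l', ((m l).sum fun q a => a * ψ l' q) = if l' = l then 1 else 0 := by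
  have hsurj : Function.Surjective
      (Finsupp.linearCombination ℂ (fun q => (fun l => ψ l q : ι → ℂ))) := by
    rw [← LinearMap.range_eq_top]
    by_contra hne
    obtain ⟨f, hf, hle⟩ := Submodule.exists_le_ker_of_lt_top _ (lt_top_iff_ne_top.2 hne)
    refine hf (LinearMap.pi_ext' fun l => LinearMap.ext_ring ?_)
    have h0 : ∑ l, f (Pi.single l 1) • ψ l = 0 := by
      funext q
      have h1 := LinearMap.mem_ker.1 (hle ⟨Finsupp.single q 1, rfl⟩)
      rw [Finsupp.linearCombination_single, one_smul, LinearMap.pi_apply_eq_sum_univ f] at h1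
      simp only [Finset.sum_apply, Pi.smul_apply, Pi.zero_apply, smul_eq_mul] at h1 ⊢
      rw [← h1]
      refine Finset.sum_congr rfl fun l _ => ?_
      rw [mul_comm]
      congr 2
      funext i
      simp [Pi.single_apply, eq_comm]
    simpa using Fintype.linearIndependent_iff.1 hψ _ h0 l
  choose m hm using fun l => hsurj (Pi.single l 1)
  refine ⟨m, fun l l' => ?_⟩
  have := congrFun (hm l) l'
  rw [Finsupp.linearCombination_apply, Finsupp.sum, Finset.sum_apply, Pi.single_apply] at this
  exact this

/-- A function of two variables which is, in the first variable, a combination of the `φ k` and whose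
conjugate is, in the second variable, a combination of the `ψ l`, is a combination of the products
of `φ k` with the conjugate of `ψ l`. -/
theorem exists_coeff_of_separately_span {P Q ι κ : Type*} [Fintype ι] [Fintype κ]
    {φ : ι → P → ℂ} {ψ : κ → Q → ℂ} (hψ : LinearIndependent ℂ ψ) {K : P → Q → ℂ}
    {c : Q → ι → ℂ} (hc : ∀ p q, K p q = ∑ k, c q k * φ k p)
    {d : P → κ → ℂ} (hd : ∀ p q, conj (K p q) = ∑ l, d p l * ψ l q) :
    ∃ a : ι → κ → ℂ, ∀ p q, K p q = ∑ k, ∑ l, a k l * (φ k p * conj (ψ l q)) := by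
  classical
  obtain ⟨m, hm⟩ := exists_dual_combination hψ
  have hdl : ∀ p l, d p l = (m l).sum fun q a => a * conj (K p q) := fun p l => by
    have : ((m l).sum fun q a => a * conj (K p q))
        = ∑ l', d p l' * ((m l).sum fun q a => a * ψ l' q) := by
      simp only [Finsupp.sum, hd, Finset.mul_sum]
      rw [Finset.sum_comm]
      refine Finset.sum_congr rfl fun _ _ => Finset.sum_congr rfl fun _ _ => by ring
    simp [this, hm]
  -- Applying `m l` to the conjugate of `K p ·` yields `d p l`. Expanding `K` in the `φ k` inside
  -- that finite sum and conjugating shows that the coefficient of `φ k` is this witness.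
  refine ⟨fun k l => (m l).sum fun q a => conj a * c q k, fun p q => ?_⟩
  have h1 : K p q = ∑ l, conj (d p l) * conj (ψ l q) := by
    rw [← Complex.conj_conj (K p q), hd, map_sum]
    simp only [map_mul]
  rw [h1, Finset.sum_comm]
  refine Finset.sum_congr rfl fun l _ => ?_
  have h2 : conj (d p l) = ∑ k, ((m l).sum fun q a => conj a * c q k) * φ k p := by
    rw [hdl]
    simp only [Finsupp.sum, map_sum, map_mul, Complex.conj_conj, hc, Finset.mul_sum, Finset.sum_mul]
    rw [Finset.sum_comm]
    refine Finset.sum_congr rfl fun _ _ => Finset.sum_congr rfl fun _ _ => by ring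
  rw [h2, Finset.sum_mul]
  exact Finset.sum_congr rfl fun _ _ => by ring

end LinearAlgebra

/-! ### Polarization and linear operations on sesquilinear forms -/

section Sesquilinear

variable {E F : Type*} [NormedAddCommGroup E] [NormedSpace ℂ E]
  [NormedAddCommGroup F] [NormedSpace ℂ F]

/-- Hermitian forms with the same real quadratic form are equal. -/
theorem sesq_eq_of_re_self_eq {V : Type*} [AddCommGroup V] [Module ℂ V] {B B' : V → V → ℂ}
    (hadd : ∀ u v w, B (u + v) w = B u w + B v w) (hsmul : ∀ (c : ℂ) u w, B (c • u) w = c * B u w)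
    (hadd' : ∀ u v w, B' (u + v) w = B' u w + B' v w)
    (hsmul' : ∀ (c : ℂ) u w, B' (c • u) w = c * B' u w)
    (hB : ∀ u v, conj (B u v) = B v u) (hB' : ∀ u v, conj (B' u v) = B' v u)
    (h : ∀ u, (B u u).re = (B' u u).re) (u v : V) : B u v = B' u v := by
  have key : ∀ u v, (B u v).re = (B' u v).re := fun u v => by
    have h1 := h (u + v)
    have e : ∀ w, B w (u + v) = B w u + B w v := fun w => by
      rw [← hB, hadd, map_add, hB, hB]
    have e' : ∀ w, B' w (u + v) = B' w u + B' w v := fun w => by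
      rw [← hB', hadd', map_add, hB', hB']
    have s : (B v u).re = (B u v).re := by rw [← hB, Complex.conj_re]
    have s' : (B' v u).re = (B' u v).re := by rw [← hB', Complex.conj_re]
    simp only [hadd, hadd', e, e', Complex.add_re, s, s'] at h1
    have := h u
    have := h v
    linarith
  refine Complex.ext (key u v) ?_
  -- The real part at `i u` is minus the imaginary part at `u`.
  have h1 := key (Complex.I • u) v
  simp only [hsmul, hsmul', Complex.I_mul_re] at h1
  linarith

/-- The pullback of sesquilinear forms along a fixed linear map, as a continuous linear map. -/
noncomputable def pullSesqL (D : E →L[ℂ] F) :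
    (F →L[ℂ] F →L⋆[ℂ] ℂ) →L[ℂ] (E →L[ℂ] E →L⋆[ℂ] ℂ) :=
  (ContinuousLinearMap.compL ℂ E (F →L⋆[ℂ] ℂ) (E →L⋆[ℂ] ℂ)
    ((ContinuousLinearMap.compSL E F ℂ (RingHom.id ℂ) (starRingEnd ℂ)).flip D)).comp
  ((ContinuousLinearMap.compL ℂ E F (F →L⋆[ℂ] ℂ)).flip D)

/-- The linear form `v ↦ B (D v) u`, as a continuous linear function of `B`. -/
noncomputable def partialSesqL (D : E →L[ℂ] F) (u : F) :
    (F →L[ℂ] F →L⋆[ℂ] ℂ) →L[ℂ] (E →L[ℂ] ℂ) :=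
  (ContinuousLinearMap.compL ℂ E (F →L⋆[ℂ] ℂ) ℂ (ContinuousLinearMap.apply' ℂ (starRingEnd ℂ) u)).comp
  ((ContinuousLinearMap.compL ℂ E F (F →L⋆[ℂ] ℂ)).flip D)

theorem partialSesqL_apply (D : E →L[ℂ] F) (u : F) (B : F →L[ℂ] F →L⋆[ℂ] ℂ) (v : E) :
    partialSesqL D u B v = B (D v) u := rfl

end Sesquilinear

/-! ### From charts to tangent vectors -/

section Chart

variable {E : Type*} [NormedAddCommGroup E] [NormedSpace ℂ E] {H : Type*} [TopologicalSpace H]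
  {I : ModelWithCorners ℂ E H} {M : Type*} [TopologicalSpace M] [ChartedSpace H M]
  [I.Boundaryless] [IsManifold I 1 M]

/-- In the chart around `x` the coordinate frame is invertible, so it reaches every tangent vector
at `x`. The identification of `x` with the inverse chart at its own coordinates is handled here
once, by transport. -/
theorem forall_tangent_of_forall_chart {P : ∀ x : M, TangentSpace I x → Prop}
    (hP : ∀ (c : M), ∀ z ∈ (extChartAt I c).target, ∀ u : E,
      P ((extChartAt I c).symm z) (coordFrame I c z u)) (x : M) (u : TangentSpace I x) : P x u := by
  have h1 : ∀ u, P ((extChartAt I x).symm (extChartAt I x x)) u := fun u => by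
    obtain ⟨A, hA⟩ := HermitianMetric.coordFrame_isInvertible (I := I) (mem_extChartAt_target x)
    have h2 := hP x _ (mem_extChartAt_target x) (A.symm u)
    rw [← hA] at h2
    have h3 : (A : E →L[ℂ] TangentSpace I ((extChartAt I x).symm (extChartAt I x x))) (A.symm u) = u :=
      A.apply_symm_apply u
    rwa [h3] at h2
  have h0 : (extChartAt I x).symm (extChartAt I x x) = x := extChartAt_to_inv x
  exact (h0 ▸ h1 : ∀ u, P x u) u

end Chart

namespace HermitianMetric

variable {E : Type*} [NormedAddCommGroup E] [NormedSpace ℂ E] {H : Type*} [TopologicalSpace H]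
  {I : ModelWithCorners ℂ E H} {M : Type*} [TopologicalSpace M] [ChartedSpace H M]
  (h : HermitianMetric I M) [I.Boundaryless]
  {E' : Type*} [NormedAddCommGroup E'] [NormedSpace ℂ E']
  {N : Type*} [TopologicalSpace N] [ChartedSpace E' N]

/-- The derivative `∂̄_t h(j v, u)` is the conjugate of `∂ h(u, j v)` in the direction `j t`, which
vanishes by assumption. The coefficients of `α` are thus killed by all `∂̄_t`. -/
theorem mem_holomorphicOneForm_of_del_eq_zero (j : E' →L[ℂ] E) (C : N → M) (b : N → E) (u : N → E)
    (hC : ∀ c : N, ∀ w ∈ (extChartAt 𝓘(ℂ, E') c).target, b c + j w ∈ (extChartAt I (C c)).target)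
    (hdel : ∀ c : N, ∀ w ∈ (extChartAt 𝓘(ℂ, E') c).target, ∀ v : E',
      del (j v) (h.coord (C c)) (b c + j w) (u c) = 0)
    (α : ∀ p : N, TangentSpace 𝓘(ℂ, E') p →L[ℂ] ℂ)
    (hα : ∀ c : N, ∀ w ∈ (extChartAt 𝓘(ℂ, E') c).target, ∀ v : E',
      coordOneForm 𝓘(ℂ, E') α c w v = h.coord (C c) (b c + j w) (j v) (u c)) :
    α ∈ HolomorphicOneForm 𝓘(ℂ, E') N := by
  intro c w hw
  have hd : DifferentiableAt ℝ (fun z => partialSesqL j (u c) (h.coord (C c) z)) (b c + j w) :=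
    (partialSesqL j (u c)).comp_differentiableAt_real (f := h.coord (C c))
      (h.differentiableAt_coord (hC c w hw))
  have hd' : DifferentiableAt ℝ (fun w => partialSesqL j (u c) (h.coord (C c) (b c + j w))) w :=
    hd.comp (f := fun w => b c + j w) w
      ((differentiableAt_const _).add (j.restrictScalars ℝ).differentiableAt)
  have heq : coordOneForm 𝓘(ℂ, E') α c =ᶠ[𝓝 w]
      fun w => partialSesqL j (u c) (h.coord (C c) (b c + j w)) := by
    filter_upwards [(isOpen_extChartAt_target c).mem_nhds hw] with y hy
    ext v
    exact hα c y hy v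
  refine (DifferentiableAt.congr_of_eventuallyEq ?_ heq).differentiableWithinAt
  refine differentiableAt_of_delBar_eq_zero hd' fun t => ?_
  have h1 := delBar_comp_affine j (b c)
    (f := fun z => partialSesqL j (u c) (h.coord (C c) z)) hd t
  rw [delBar_clm_comp (partialSesqL j (u c)) (f := h.coord (C c))
    (h.differentiableAt_coord (hC c w hw))] at h1
  rw [h1]
  ext v
  rw [partialSesqL_apply, h.delBar_coord_apply (hC c w hw), hdel c w hw]
  simp

end HermitianMetric

/-! ### Coordinates and tangent vectors on a product -/

section Product

variable {EX : Type*} [NormedAddCommGroup EX] [NormedSpace ℂ EX]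
  {EY : Type*} [NormedAddCommGroup EY] [NormedSpace ℂ EY]
  {X : Type*} [TopologicalSpace X] [ChartedSpace EX X]
  {Y : Type*} [TopologicalSpace Y] [ChartedSpace EY Y]

/-- The inclusion of the tangent space of the first factor in the tangent space of a product. -/
def inlTangent (x : X) (y : Y) :
    TangentSpace 𝓘(ℂ, EX) x →L[ℂ] TangentSpace (𝓘(ℂ, EX).prod 𝓘(ℂ, EY)) (x, y) :=
  ContinuousLinearMap.inl ℂ EX EY

/-- The inclusion of the tangent space of the second factor in the tangent space of a product. -/
def inrTangent (x : X) (y : Y) :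
    TangentSpace 𝓘(ℂ, EY) y →L[ℂ] TangentSpace (𝓘(ℂ, EX).prod 𝓘(ℂ, EY)) (x, y) :=
  ContinuousLinearMap.inr ℂ EX EY

theorem mem_target_prod {cX : X} {cY : Y} {z : EX} {w : EY}
    (hz : z ∈ (extChartAt 𝓘(ℂ, EX) cX).target) (hw : w ∈ (extChartAt 𝓘(ℂ, EY) cY).target) :
    (z, w) ∈ (extChartAt (𝓘(ℂ, EX).prod 𝓘(ℂ, EY)) (cX, cY)).target := by
  rw [extChartAt_prod]
  exact ⟨hz, hw⟩

variable [IsManifold 𝓘(ℂ, EX) 1 X] [IsManifold 𝓘(ℂ, EY) 1 Y]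

theorem coordFrame_prod {cX : X} {cY : Y} {z : EX} {w : EY}
    (hz : z ∈ (extChartAt 𝓘(ℂ, EX) cX).target) (hw : w ∈ (extChartAt 𝓘(ℂ, EY) cY).target)
    (u : EX) (v : EY) :
    coordFrame (𝓘(ℂ, EX).prod 𝓘(ℂ, EY)) (cX, cY) (z, w) (u, v)
      = inlTangent ((extChartAt 𝓘(ℂ, EX) cX).symm z) ((extChartAt 𝓘(ℂ, EY) cY).symm w)
          (coordFrame 𝓘(ℂ, EX) cX z u)
        + inrTangent ((extChartAt 𝓘(ℂ, EX) cX).symm z) ((extChartAt 𝓘(ℂ, EY) cY).symm w)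
          (coordFrame 𝓘(ℂ, EY) cY w v) := by
  have hX : MDifferentiableAt 𝓘(ℂ, EX) 𝓘(ℂ, EX) (extChartAt 𝓘(ℂ, EX) cX).symm z := by
    have := mdifferentiableWithinAt_extChartAt_symm hz
    rwa [ModelWithCorners.range_eq_univ, mdifferentiableWithinAt_univ] at this
  have hY : MDifferentiableAt 𝓘(ℂ, EY) 𝓘(ℂ, EY) (extChartAt 𝓘(ℂ, EY) cY).symm w := by
    have := mdifferentiableWithinAt_extChartAt_symm hw
    rwa [ModelWithCorners.range_eq_univ, mdifferentiableWithinAt_univ] at this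
  have h1 : MDifferentiableAt 𝓘(ℂ, EX × EY) 𝓘(ℂ, EX) (Prod.fst : EX × EY → EX) (z, w) :=
    differentiableAt_fst.mdifferentiableAt
  have h2 : MDifferentiableAt 𝓘(ℂ, EX × EY) 𝓘(ℂ, EY) (Prod.snd : EX × EY → EY) (z, w) :=
    differentiableAt_snd.mdifferentiableAt
  have h3 := mfderiv_prodMk (MDifferentiableAt.comp (z, w) hX h1)
    (MDifferentiableAt.comp (z, w) hY h2)
  rw [mfderiv_comp (z, w) hX h1, mfderiv_comp (z, w) hY h2, mfderiv_eq_fderiv,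
    mfderiv_eq_fderiv, fderiv_fst, fderiv_snd] at h3
  have h4 := congrArg (fun L => (L (u, v) : EX × EY)) h3
  refine Eq.trans h4 ?_
  refine Prod.ext ?_ ?_
  · exact (add_zero (mfderiv 𝓘(ℂ, EX) 𝓘(ℂ, EX) (extChartAt 𝓘(ℂ, EX) cX).symm z u)).symm
  · exact (zero_add (mfderiv 𝓘(ℂ, EY) 𝓘(ℂ, EY) (extChartAt 𝓘(ℂ, EY) cY).symm w v)).symm

end Product

/-! ### Holomorphic forms as functions of a tangent vector -/

section Evaluation

/-- The evaluation of holomorphic forms at a tangent vector. -/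
noncomputable def HolomorphicOneForm.eval {E : Type*} [NormedAddCommGroup E]
    [NormedSpace ℂ E] {N : Type*} [TopologicalSpace N] [ChartedSpace E N]
    (q : Σ y : N, TangentSpace 𝓘(ℂ, E) y) : HolomorphicOneForm 𝓘(ℂ, E) N →ₗ[ℂ] ℂ where
  toFun α := (α : ∀ y : N, TangentSpace 𝓘(ℂ, E) y →L[ℂ] ℂ) q.1 q.2
  map_add' _ _ := rfl
  map_smul' _ _ := rfl

/-- Viewing a form as a scalar function on pairs of a point and a tangent vector brings it within
reach of `exists_coeff_of_separately_span`. -/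
theorem HolomorphicOneForm.exists_eq_sum {E : Type*} [NormedAddCommGroup E]
    [NormedSpace ℂ E] {N : Type*} [TopologicalSpace N] [ChartedSpace E N] {ι : Type*} [Fintype ι]
    (ψ : Module.Basis ι ℂ (HolomorphicOneForm 𝓘(ℂ, E) N))
    {α : ∀ y : N, TangentSpace 𝓘(ℂ, E) y →L[ℂ] ℂ} (hα : α ∈ HolomorphicOneForm 𝓘(ℂ, E) N) :
    ∃ c : ι → ℂ, ∀ q : Σ y : N, TangentSpace 𝓘(ℂ, E) y,
      α q.1 q.2 = ∑ l, c l * HolomorphicOneForm.eval q (ψ l) := by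
  refine ⟨ψ.repr ⟨α, hα⟩, fun q => ?_⟩
  have h1 := congrArg (HolomorphicOneForm.eval q) (ψ.sum_repr ⟨α, hα⟩)
  rw [map_sum] at h1
  exact h1.symm

theorem HolomorphicOneForm.linearIndependent_eval {E : Type*}
    [NormedAddCommGroup E] [NormedSpace ℂ E] {N : Type*} [TopologicalSpace N] [ChartedSpace E N]
    {ι : Type*} [Fintype ι] (ψ : Module.Basis ι ℂ (HolomorphicOneForm 𝓘(ℂ, E) N)) :
    LinearIndependent ℂ fun l (q : Σ y : N, TangentSpace 𝓘(ℂ, E) y) =>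
      HolomorphicOneForm.eval q (ψ l) := by
  rw [Fintype.linearIndependent_iff]
  intro g hg
  suffices h0 : ψ.equivFun.symm g = 0 from
    congrFun ((LinearEquiv.map_eq_zero_iff ψ.equivFun.symm).1 h0)
  rw [Module.Basis.equivFun_symm_apply]
  refine Subtype.ext (funext fun y => ?_)
  ext v
  have h1 := congrFun hg ⟨y, v⟩
  rw [Finset.sum_apply] at h1
  have h2 := map_sum (HolomorphicOneForm.eval ⟨y, v⟩) (fun l => g l • ψ l) Finset.univ
  exact h2.trans h1

end Evaluation

/-! ### The blocks of a metric on a product -/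

namespace HermitianMetric

variable {EX : Type*} [NormedAddCommGroup EX] [NormedSpace ℂ EX]
  {EY : Type*} [NormedAddCommGroup EY] [NormedSpace ℂ EY]
  {X : Type*} [TopologicalSpace X] [ChartedSpace EX X]
  {Y : Type*} [TopologicalSpace Y] [ChartedSpace EY Y]
  [IsManifold 𝓘(ℂ, EX) 1 X] [IsManifold 𝓘(ℂ, EY) 1 Y]
  {h : HermitianMetric (𝓘(ℂ, EX).prod 𝓘(ℂ, EY)) (X × Y)}

theorem coord_prod (h : HermitianMetric (𝓘(ℂ, EX).prod 𝓘(ℂ, EY)) (X × Y))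
    {cX : X} {cY : Y} {z : EX} {w : EY}
    (hz : z ∈ (extChartAt 𝓘(ℂ, EX) cX).target) (hw : w ∈ (extChartAt 𝓘(ℂ, EY) cY).target)
    (u u' : EX) (v v' : EY) :
    h.coord (cX, cY) (z, w) (u, v) (u', v') =
      h.form ((extChartAt 𝓘(ℂ, EX) cX).symm z, (extChartAt 𝓘(ℂ, EY) cY).symm w)
        (inlTangent _ _ (coordFrame 𝓘(ℂ, EX) cX z u) + inrTangent _ _ (coordFrame 𝓘(ℂ, EY) cY w v))
        (inlTangent _ _ (coordFrame 𝓘(ℂ, EX) cX z u')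
          + inrTangent _ _ (coordFrame 𝓘(ℂ, EY) cY w v')) :=
  congrArg₂ (fun a b => h.form ((extChartAt 𝓘(ℂ, EX) cX).symm z, (extChartAt 𝓘(ℂ, EY) cY).symm w) a b)
    (coordFrame_prod hz hw u v) (coordFrame_prod hz hw u' v')

theorem coord_inl_inl (h : HermitianMetric (𝓘(ℂ, EX).prod 𝓘(ℂ, EY)) (X × Y))
    {cX : X} {cY : Y} {z : EX} {w : EY}
    (hz : z ∈ (extChartAt 𝓘(ℂ, EX) cX).target) (hw : w ∈ (extChartAt 𝓘(ℂ, EY) cY).target)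
    (u u' : EX) :
    h.coord (cX, cY) (z, w) (u, 0) (u', 0) =
      h.form ((extChartAt 𝓘(ℂ, EX) cX).symm z, (extChartAt 𝓘(ℂ, EY) cY).symm w)
        (inlTangent _ _ (coordFrame 𝓘(ℂ, EX) cX z u))
        (inlTangent _ _ (coordFrame 𝓘(ℂ, EX) cX z u')) := by
  rw [h.coord_prod hz hw, map_zero, map_zero, add_zero, add_zero]

theorem coord_inr_inr (h : HermitianMetric (𝓘(ℂ, EX).prod 𝓘(ℂ, EY)) (X × Y))
    {cX : X} {cY : Y} {z : EX} {w : EY}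
    (hz : z ∈ (extChartAt 𝓘(ℂ, EX) cX).target) (hw : w ∈ (extChartAt 𝓘(ℂ, EY) cY).target)
    (v v' : EY) :
    h.coord (cX, cY) (z, w) (0, v) (0, v') =
      h.form ((extChartAt 𝓘(ℂ, EX) cX).symm z, (extChartAt 𝓘(ℂ, EY) cY).symm w)
        (inrTangent _ _ (coordFrame 𝓘(ℂ, EY) cY w v))
        (inrTangent _ _ (coordFrame 𝓘(ℂ, EY) cY w v')) := by
  rw [h.coord_prod hz hw, map_zero, map_zero, zero_add, zero_add]

theorem coord_inl_inr (h : HermitianMetric (𝓘(ℂ, EX).prod 𝓘(ℂ, EY)) (X × Y))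
    {cX : X} {cY : Y} {z : EX} {w : EY}
    (hz : z ∈ (extChartAt 𝓘(ℂ, EX) cX).target) (hw : w ∈ (extChartAt 𝓘(ℂ, EY) cY).target)
    (u : EX) (v : EY) :
    h.coord (cX, cY) (z, w) (u, 0) (0, v) =
      h.form ((extChartAt 𝓘(ℂ, EX) cX).symm z, (extChartAt 𝓘(ℂ, EY) cY).symm w)
        (inlTangent _ _ (coordFrame 𝓘(ℂ, EX) cX z u))
        (inrTangent _ _ (coordFrame 𝓘(ℂ, EY) cY w v)) := by
  rw [h.coord_prod hz hw, map_zero, map_zero, map_zero, map_zero, zero_add, add_zero]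

theorem coord_inr_inl (h : HermitianMetric (𝓘(ℂ, EX).prod 𝓘(ℂ, EY)) (X × Y))
    {cX : X} {cY : Y} {z : EX} {w : EY}
    (hz : z ∈ (extChartAt 𝓘(ℂ, EX) cX).target) (hw : w ∈ (extChartAt 𝓘(ℂ, EY) cY).target)
    (u : EX) (v : EY) :
    h.coord (cX, cY) (z, w) (0, v) (u, 0) =
      h.form ((extChartAt 𝓘(ℂ, EX) cX).symm z, (extChartAt 𝓘(ℂ, EY) cY).symm w)
        (inrTangent _ _ (coordFrame 𝓘(ℂ, EY) cY w v))
        (inlTangent _ _ (coordFrame 𝓘(ℂ, EX) cX z u)) := by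
  rw [h.coord_prod hz hw, map_zero, map_zero, map_zero, map_zero, zero_add, add_zero]

theorem base_add_inr (z : EX) (w : EY) :
    (z, (0 : EY)) + ContinuousLinearMap.inr ℂ EX EY w = (z, w) := by simp

theorem base_add_inl (z : EX) (w : EY) :
    ((0 : EX), w) + ContinuousLinearMap.inl ℂ EX EY z = (z, w) := by simp

section Slices

variable [FiniteDimensional ℂ EX] [FiniteDimensional ℂ EY]

section SecondFactor

variable [CompactSpace Y] [ConnectedSpace Y]

theorem NonposBisectionalCurvature.eq_const_and_del_eq_zero_right
    (hh : h.NonposBisectionalCurvature) {cX : X} {z : EX}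
    (hz : z ∈ (extChartAt 𝓘(ℂ, EX) cX).target) {u : EX} (hu : u ≠ 0) :
    (∀ y y' : Y, (h.form ((extChartAt 𝓘(ℂ, EX) cX).symm z, y)
        (inlTangent _ y (coordFrame 𝓘(ℂ, EX) cX z u))
        (inlTangent _ y (coordFrame 𝓘(ℂ, EX) cX z u))).re
      = (h.form ((extChartAt 𝓘(ℂ, EX) cX).symm z, y')
        (inlTangent _ y' (coordFrame 𝓘(ℂ, EX) cX z u))
        (inlTangent _ y' (coordFrame 𝓘(ℂ, EX) cX z u))).re) ∧
    ∀ cY : Y, ∀ w ∈ (extChartAt 𝓘(ℂ, EY) cY).target, ∀ v : EY,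
      del (ContinuousLinearMap.inr ℂ EX EY v) (h.coord (cX, cY))
        ((z, 0) + ContinuousLinearMap.inr ℂ EX EY w) (u, 0) = 0 := by
  refine hh.eq_const_and_del_eq_zero (N := Y) (ContinuousLinearMap.inr ℂ EX EY)
    (Prod.mk_right_injective 0)
    (fun cY => (cX, cY)) (fun _ => (z, 0)) (fun _ => (u, 0)) (fun _ => by simpa using hu)
    (fun y => (h.form ((extChartAt 𝓘(ℂ, EX) cX).symm z, y)
        (inlTangent _ y (coordFrame 𝓘(ℂ, EX) cX z u))
        (inlTangent _ y (coordFrame 𝓘(ℂ, EX) cX z u))).re) (fun cY w hw => ?_) fun cY w hw => ?_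
  · rw [base_add_inr]
    exact mem_target_prod hz hw
  · rw [base_add_inr, h.coord_inl_inl hz hw]

/-- The rigidity gives equality of the norms of a single vector; polarization extends it to pairs.
-/
theorem NonposBisectionalCurvature.form_inl_inl_eq (hh : h.NonposBisectionalCurvature)
    (x : X) (u u' : TangentSpace 𝓘(ℂ, EX) x) (y y' : Y) :
    h.form (x, y) (inlTangent x y u) (inlTangent x y u')
      = h.form (x, y') (inlTangent x y' u) (inlTangent x y' u') := by
  refine sesq_eq_of_re_self_eq (V := TangentSpace 𝓘(ℂ, EX) x)
    (B := fun u u' => h.form (x, y) (inlTangent x y u) (inlTangent x y u'))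
    (B' := fun u u' => h.form (x, y') (inlTangent x y' u) (inlTangent x y' u'))
    (by simp) (by simp) (by simp) (by simp) (fun _ _ => h.conj_symm _ _ _)
    (fun _ _ => h.conj_symm _ _ _) (fun u => ?_) u u'
  refine forall_tangent_of_forall_chart (I := 𝓘(ℂ, EX)) (P := fun x u =>
    (h.form (x, y) (inlTangent x y u) (inlTangent x y u)).re
      = (h.form (x, y') (inlTangent x y' u) (inlTangent x y' u)).re) (fun c z hz u => ?_) x u
  rcases eq_or_ne u 0 with rfl | hu
  · rw [(coordFrame 𝓘(ℂ, EX) c z).map_zero, map_zero, map_zero, map_zero, map_zero]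
  · exact (hh.eq_const_and_del_eq_zero_right hz hu).1 y y'

/-- The vector of `X` sits in the conjugate-linear slot, which leaves a complex linear form on the
tangent spaces of `Y`. -/
theorem NonposBisectionalCurvature.form_inr_inl_mem_holomorphicOneForm
    (hh : h.NonposBisectionalCurvature) (x : X) (u : TangentSpace 𝓘(ℂ, EX) x) :
    (fun y : Y => partialSesqL (E := EY) (F := EX × EY) (inrTangent x y) (inlTangent x y u)
      (h.form (x, y)) : ∀ y : Y, TangentSpace 𝓘(ℂ, EY) y →L[ℂ] ℂ)
      ∈ HolomorphicOneForm 𝓘(ℂ, EY) Y := by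
  refine forall_tangent_of_forall_chart (I := 𝓘(ℂ, EX)) (P := fun x u =>
    (fun y : Y => partialSesqL (E := EY) (F := EX × EY) (inrTangent x y) (inlTangent x y u)
      (h.form (x, y)) : ∀ y : Y, TangentSpace 𝓘(ℂ, EY) y →L[ℂ] ℂ)
      ∈ HolomorphicOneForm 𝓘(ℂ, EY) Y) (fun cX z hz u => ?_) x u
  refine h.mem_holomorphicOneForm_of_del_eq_zero (N := Y) (ContinuousLinearMap.inr ℂ EX EY)
    (fun cY => (cX, cY)) (fun _ => (z, 0)) (fun _ => (u, 0)) (fun cY w hw => ?_)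
    (fun cY w hw v => ?_) _ (fun cY w hw v => ?_)
  · rw [base_add_inr]
    exact mem_target_prod hz hw
  · rcases eq_or_ne u 0 with rfl | hu
    · exact map_zero _
    · exact (hh.eq_const_and_del_eq_zero_right hz hu).2 cY w hw v
  · rw [base_add_inr]
    exact (h.coord_inr_inl hz hw u v).symm

end SecondFactor

section FirstFactor

variable [CompactSpace X] [ConnectedSpace X]

theorem NonposBisectionalCurvature.eq_const_and_del_eq_zero_left
    (hh : h.NonposBisectionalCurvature) {cY : Y} {w : EY}
    (hw : w ∈ (extChartAt 𝓘(ℂ, EY) cY).target) {v : EY} (hv : v ≠ 0) :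
    (∀ x x' : X, (h.form (x, (extChartAt 𝓘(ℂ, EY) cY).symm w)
        (inrTangent x _ (coordFrame 𝓘(ℂ, EY) cY w v))
        (inrTangent x _ (coordFrame 𝓘(ℂ, EY) cY w v))).re
      = (h.form (x', (extChartAt 𝓘(ℂ, EY) cY).symm w)
        (inrTangent x' _ (coordFrame 𝓘(ℂ, EY) cY w v))
        (inrTangent x' _ (coordFrame 𝓘(ℂ, EY) cY w v))).re) ∧
    ∀ cX : X, ∀ z ∈ (extChartAt 𝓘(ℂ, EX) cX).target, ∀ u : EX,
      del (ContinuousLinearMap.inl ℂ EX EY u) (h.coord (cX, cY))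
        ((0, w) + ContinuousLinearMap.inl ℂ EX EY z) (0, v) = 0 := by
  refine hh.eq_const_and_del_eq_zero (N := X) (ContinuousLinearMap.inl ℂ EX EY)
    (Prod.mk_left_injective 0)
    (fun cX => (cX, cY)) (fun _ => (0, w)) (fun _ => (0, v)) (fun _ => by simpa using hv)
    (fun x => (h.form (x, (extChartAt 𝓘(ℂ, EY) cY).symm w)
        (inrTangent x _ (coordFrame 𝓘(ℂ, EY) cY w v))
        (inrTangent x _ (coordFrame 𝓘(ℂ, EY) cY w v))).re) (fun cX z hz => ?_) fun cX z hz => ?_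
  · rw [base_add_inl]
    exact mem_target_prod hz hw
  · rw [base_add_inl, h.coord_inr_inr hz hw]

theorem NonposBisectionalCurvature.form_inr_inr_eq (hh : h.NonposBisectionalCurvature)
    (y : Y) (v v' : TangentSpace 𝓘(ℂ, EY) y) (x x' : X) :
    h.form (x, y) (inrTangent x y v) (inrTangent x y v')
      = h.form (x', y) (inrTangent x' y v) (inrTangent x' y v') := by
  refine sesq_eq_of_re_self_eq (V := TangentSpace 𝓘(ℂ, EY) y)
    (B := fun v v' => h.form (x, y) (inrTangent x y v) (inrTangent x y v'))
    (B' := fun v v' => h.form (x', y) (inrTangent x' y v) (inrTangent x' y v'))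
    (by simp) (by simp) (by simp) (by simp) (fun _ _ => h.conj_symm _ _ _)
    (fun _ _ => h.conj_symm _ _ _) (fun v => ?_) v v'
  refine forall_tangent_of_forall_chart (I := 𝓘(ℂ, EY)) (P := fun y v =>
    (h.form (x, y) (inrTangent x y v) (inrTangent x y v)).re
      = (h.form (x', y) (inrTangent x' y v) (inrTangent x' y v)).re) (fun c w hw v => ?_) y v
  rcases eq_or_ne v 0 with rfl | hv
  · rw [(coordFrame 𝓘(ℂ, EY) c w).map_zero, map_zero, map_zero, map_zero, map_zero]
  · exact (hh.eq_const_and_del_eq_zero_left hw hv).1 x x'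

theorem NonposBisectionalCurvature.form_inl_inr_mem_holomorphicOneForm
    (hh : h.NonposBisectionalCurvature) (y : Y) (v : TangentSpace 𝓘(ℂ, EY) y) :
    (fun x : X => partialSesqL (E := EX) (F := EX × EY) (inlTangent x y) (inrTangent x y v)
      (h.form (x, y)) : ∀ x : X, TangentSpace 𝓘(ℂ, EX) x →L[ℂ] ℂ)
      ∈ HolomorphicOneForm 𝓘(ℂ, EX) X := by
  refine forall_tangent_of_forall_chart (I := 𝓘(ℂ, EY)) (P := fun y v =>
    (fun x : X => partialSesqL (E := EX) (F := EX × EY) (inlTangent x y) (inrTangent x y v)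
      (h.form (x, y)) : ∀ x : X, TangentSpace 𝓘(ℂ, EX) x →L[ℂ] ℂ)
      ∈ HolomorphicOneForm 𝓘(ℂ, EX) X) (fun cY w hw v => ?_) y v
  refine h.mem_holomorphicOneForm_of_del_eq_zero (N := X) (ContinuousLinearMap.inl ℂ EX EY)
    (fun cX => (cX, cY)) (fun _ => (0, w)) (fun _ => (0, v)) (fun cX z hz => ?_)
    (fun cX z hz u => ?_) _ (fun cX z hz u => ?_)
  · rw [base_add_inl]
    exact mem_target_prod hz hw
  · rcases eq_or_ne v 0 with rfl | hv
    · exact map_zero _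
    · exact (hh.eq_const_and_del_eq_zero_left hw hv).2 cX z hz u
  · rw [base_add_inl]
    exact (h.coord_inl_inr hz hw u v).symm

end FirstFactor

end Slices

section Restriction

/-- The metric induced on the first factor of a product. -/
noncomputable def restrictFst (h : HermitianMetric (𝓘(ℂ, EX).prod 𝓘(ℂ, EY)) (X × Y))
    {cY : Y} {w : EY} (hw : w ∈ (extChartAt 𝓘(ℂ, EY) cY).target) :
    HermitianMetric 𝓘(ℂ, EX) X where
  form x := pullSesq (E := EX) (F := EX × EY) (inlTangent x ((extChartAt 𝓘(ℂ, EY) cY).symm w))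
    (h.form (x, (extChartAt 𝓘(ℂ, EY) cY).symm w))
  conj_symm x u v := h.conj_symm _ _ _
  pos x u hu := h.pos _ _ fun h0 => hu (congrArg Prod.fst (show ((u, 0) : EX × EY) = 0 from h0))
  smooth c := by
    -- In the product chart `(c, cY)` the coefficients are those of `h` at `(z, w)` with `w` fixed,
    -- pulled back by the constant linear map `inl`; both operations preserve smoothness.
    intro z hz
    have h1 : @ContDiffAt ℝ _ (EX × EY) _ _ ((EX × EY) →L[ℂ] (EX × EY) →L⋆[ℂ] ℂ) _
        NormedSpace.complexToReal ∞ (h.coord (c, cY)) (z, w) :=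
      (h.smooth (c, cY)).contDiffAt ((isOpen_extChartAt_target _).mem_nhds (mem_target_prod hz hw))
    have h2 : @ContDiffAt ℝ _ EX _ _ ((EX × EY) →L[ℂ] (EX × EY) →L⋆[ℂ] ℂ) _
        NormedSpace.complexToReal ∞ (fun z => h.coord (c, cY) (z, w)) z :=
      ContDiffAt.comp (f := fun z => (z, w)) z h1 (contDiff_id.prodMk contDiff_const).contDiffAt
    have h3 := ContinuousLinearMap.comp_contDiffAt_real (G := EX →L[ℂ] EX →L⋆[ℂ] ℂ)
      (pullSesqL (ContinuousLinearMap.inl ℂ EX EY)) (f := fun z => h.coord (c, cY) (z, w)) h2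
    refine (ContDiffAt.congr_of_eventuallyEq h3 ?_).contDiffWithinAt
    filter_upwards [(isOpen_extChartAt_target c).mem_nhds hz] with y hy
    ext u u'
    exact (h.coord_inl_inl hy hw u u').symm

/-- The metric induced on the second factor of a product. -/
noncomputable def restrictSnd (h : HermitianMetric (𝓘(ℂ, EX).prod 𝓘(ℂ, EY)) (X × Y))
    {cX : X} {z : EX} (hz : z ∈ (extChartAt 𝓘(ℂ, EX) cX).target) :
    HermitianMetric 𝓘(ℂ, EY) Y where
  form y := pullSesq (E := EY) (F := EX × EY) (inrTangent ((extChartAt 𝓘(ℂ, EX) cX).symm z) y)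
    (h.form ((extChartAt 𝓘(ℂ, EX) cX).symm z, y))
  conj_symm y u v := h.conj_symm _ _ _
  pos y v hv := h.pos _ _ fun h0 => hv (congrArg Prod.snd (show ((0, v) : EX × EY) = 0 from h0))
  smooth c := by
    intro w hw
    have h1 : @ContDiffAt ℝ _ (EX × EY) _ _ ((EX × EY) →L[ℂ] (EX × EY) →L⋆[ℂ] ℂ) _
        NormedSpace.complexToReal ∞ (h.coord (cX, c)) (z, w) :=
      (h.smooth (cX, c)).contDiffAt ((isOpen_extChartAt_target _).mem_nhds (mem_target_prod hz hw))
    have h2 : @ContDiffAt ℝ _ EY _ _ ((EX × EY) →L[ℂ] (EX × EY) →L⋆[ℂ] ℂ) _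
        NormedSpace.complexToReal ∞ (fun w => h.coord (cX, c) (z, w)) w :=
      ContDiffAt.comp (f := fun w => (z, w)) w h1 (contDiff_const.prodMk contDiff_id).contDiffAt
    have h3 := ContinuousLinearMap.comp_contDiffAt_real (G := EY →L[ℂ] EY →L⋆[ℂ] ℂ)
      (pullSesqL (ContinuousLinearMap.inr ℂ EX EY)) (f := fun w => h.coord (cX, c) (z, w)) h2
    refine (ContDiffAt.congr_of_eventuallyEq h3 ?_).contDiffWithinAt
    filter_upwards [(isOpen_extChartAt_target c).mem_nhds hw] with y hy
    ext v v'
    exact (h.coord_inr_inr hz hy v v').symm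

variable [FiniteDimensional ℂ EX] [FiniteDimensional ℂ EY]

theorem NonposBisectionalCurvature.restrictFst (hh : h.NonposBisectionalCurvature)
    {cY : Y} {w : EY} (hw : w ∈ (extChartAt 𝓘(ℂ, EY) cY).target) :
    (h.restrictFst hw).NonposBisectionalCurvature := by
  refine hh.of_slice (N := X) _ (ContinuousLinearMap.inl ℂ EX EY) (Prod.mk_left_injective 0)
    (fun cX => (cX, cY)) (fun _ => (0, w)) (fun cX z hz => ?_) fun cX z hz u u' => ?_
  · rw [base_add_inl]
    exact mem_target_prod hz hw
  · rw [base_add_inl]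
    exact (h.coord_inl_inl hz hw u u').symm

theorem NonposBisectionalCurvature.restrictSnd (hh : h.NonposBisectionalCurvature)
    {cX : X} {z : EX} (hz : z ∈ (extChartAt 𝓘(ℂ, EX) cX).target) :
    (h.restrictSnd hz).NonposBisectionalCurvature := by
  refine hh.of_slice (N := Y) _ (ContinuousLinearMap.inr ℂ EX EY) (Prod.mk_right_injective 0)
    (fun cY => (cX, cY)) (fun _ => (z, 0)) (fun cY w hw => ?_) fun cY w hw v v' => ?_
  · rw [base_add_inr]
    exact mem_target_prod hz hw
  · rw [base_add_inr]
    exact (h.coord_inr_inr hz hw v v').symm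

end Restriction

section MixedPart

variable [FiniteDimensional ℂ EX] [FiniteDimensional ℂ EY]
  [CompactSpace X] [ConnectedSpace X] [CompactSpace Y] [ConnectedSpace Y]

/-- For fixed `v` the mixed block is a holomorphic form on `X`, hence a combination of the `φ k`.
Its conjugate is, for fixed `u`, a holomorphic form on `Y`, hence a combination of the `ψ l`. -/
theorem NonposBisectionalCurvature.exists_form_inl_inr_eq (hh : h.NonposBisectionalCurvature)
    {r s : ℕ} (φ : Module.Basis (Fin r) ℂ (HolomorphicOneForm 𝓘(ℂ, EX) X))
    (ψ : Module.Basis (Fin s) ℂ (HolomorphicOneForm 𝓘(ℂ, EY) Y)) :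
    ∃ a : Fin r → Fin s → ℂ, ∀ (x : X) (y : Y) (u : TangentSpace 𝓘(ℂ, EX) x)
      (v : TangentSpace 𝓘(ℂ, EY) y), h.form (x, y) (inlTangent x y u) (inrTangent x y v)
        = ∑ k, ∑ l, a k l * (HolomorphicOneForm.toOneForm (φ k) x u
          * conj (HolomorphicOneForm.toOneForm (ψ l) y v)) := by
  choose c hc using fun q : Σ y : Y, TangentSpace 𝓘(ℂ, EY) y => HolomorphicOneForm.exists_eq_sum φ
    (hh.form_inl_inr_mem_holomorphicOneForm q.1 q.2)
  choose d hd using fun p : Σ x : X, TangentSpace 𝓘(ℂ, EX) x => HolomorphicOneForm.exists_eq_sum ψ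
    (hh.form_inr_inl_mem_holomorphicOneForm p.1 p.2)
  have hψ := HolomorphicOneForm.linearIndependent_eval ψ
  have h1 : ∀ (p : Σ x : X, TangentSpace 𝓘(ℂ, EX) x) (q : Σ y : Y, TangentSpace 𝓘(ℂ, EY) y),
      h.form (p.1, q.1) (inlTangent p.1 q.1 p.2) (inrTangent p.1 q.1 q.2)
        = ∑ k, c q k * HolomorphicOneForm.eval p (φ k) := fun p q => hc q p
  have h2 : ∀ (p : Σ x : X, TangentSpace 𝓘(ℂ, EX) x) (q : Σ y : Y, TangentSpace 𝓘(ℂ, EY) y),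
      conj (h.form (p.1, q.1) (inlTangent p.1 q.1 p.2) (inrTangent p.1 q.1 q.2))
        = ∑ l, d p l * HolomorphicOneForm.eval q (ψ l) := fun p q => by
    rw [h.conj_symm]
    exact hd p q
  obtain ⟨a, ha⟩ := exists_coeff_of_separately_span
    (φ := fun k p => HolomorphicOneForm.eval p (φ k))
    (ψ := fun l q => HolomorphicOneForm.eval q (ψ l))
    hψ
    (K := fun p q => h.form (p.1, q.1) (inlTangent p.1 q.1 p.2) (inrTangent p.1 q.1 q.2))
    (c := c) h1 (d := d) h2
  exact ⟨a, fun x y u v => ha ⟨x, u⟩ ⟨y, v⟩⟩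

end MixedPart

end HermitianMetric

/-! ### Evaluation of the two-forms in the decomposition -/

section Assembly

variable {EX : Type*} [NormedAddCommGroup EX] [NormedSpace ℂ EX]
  {EY : Type*} [NormedAddCommGroup EY] [NormedSpace ℂ EY]
  {X : Type*} [TopologicalSpace X] [ChartedSpace EX X]
  {Y : Type*} [TopologicalSpace Y] [ChartedSpace EY Y]

/-- The component in the first factor of a tangent vector of a product. -/
def fstTangent {x : X} {y : Y} (v : TangentSpace (𝓘(ℂ, EX).prod 𝓘(ℂ, EY)) (x, y)) :
    TangentSpace 𝓘(ℂ, EX) x := (show EX × EY from v).1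

/-- The component in the second factor of a tangent vector of a product. -/
def sndTangent {x : X} {y : Y} (v : TangentSpace (𝓘(ℂ, EX).prod 𝓘(ℂ, EY)) (x, y)) :
    TangentSpace 𝓘(ℂ, EY) y := (show EX × EY from v).2

theorem inlTangent_add_inrTangent {x : X} {y : Y}
    (v : TangentSpace (𝓘(ℂ, EX).prod 𝓘(ℂ, EY)) (x, y)) :
    inlTangent x y (fstTangent v) + inrTangent x y (sndTangent v) = v :=
  Prod.ext (add_zero (show EX × EY from v).1) (zero_add (show EX × EY from v).2)

theorem mfderiv_fst_apply {x : X} {y : Y} (v : TangentSpace (𝓘(ℂ, EX).prod 𝓘(ℂ, EY)) (x, y)) :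
    mfderiv (𝓘(ℂ, EX).prod 𝓘(ℂ, EY)) 𝓘(ℂ, EX) (Prod.fst : X × Y → X) (x, y) v = fstTangent v := by
  rw [mfderiv_fst]
  rfl

theorem mfderiv_snd_apply {x : X} {y : Y} (v : TangentSpace (𝓘(ℂ, EX).prod 𝓘(ℂ, EY)) (x, y)) :
    mfderiv (𝓘(ℂ, EX).prod 𝓘(ℂ, EY)) 𝓘(ℂ, EY) (Prod.snd : X × Y → Y) (x, y) v = sndTangent v := by
  rw [mfderiv_snd]
  rfl

theorem HermitianMetric.kahlerForm_apply {E : Type*} [NormedAddCommGroup E] [NormedSpace ℂ E]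
    {H : Type*} [TopologicalSpace H] {I : ModelWithCorners ℂ E H} {M : Type*} [TopologicalSpace M]
    [ChartedSpace H M] (h : HermitianMetric I M) (p : M) (v : Fin 2 → TangentSpace I p) :
    h.kahlerForm p v = Complex.I * (h.form p (v 0) (v 1) - h.form p (v 1) (v 0)) := rfl

theorem pullback_fst_kahlerForm_apply (k : HermitianMetric 𝓘(ℂ, EX) X) (x : X) (y : Y)
    (v : Fin 2 → TangentSpace (𝓘(ℂ, EX).prod 𝓘(ℂ, EY)) (x, y)) :
    TwoForm.pullback (𝓘(ℂ, EX).prod 𝓘(ℂ, EY)) (Prod.fst : X × Y → X) k.kahlerForm (x, y) v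
      = Complex.I * (k.form x (fstTangent (v 0)) (fstTangent (v 1))
        - k.form x (fstTangent (v 1)) (fstTangent (v 0))) := by
  rw [← mfderiv_fst_apply, ← mfderiv_fst_apply]
  rfl

theorem pullback_snd_kahlerForm_apply (k : HermitianMetric 𝓘(ℂ, EY) Y) (x : X) (y : Y)
    (v : Fin 2 → TangentSpace (𝓘(ℂ, EX).prod 𝓘(ℂ, EY)) (x, y)) :
    TwoForm.pullback (𝓘(ℂ, EX).prod 𝓘(ℂ, EY)) (Prod.snd : X × Y → Y) k.kahlerForm (x, y) v
      = Complex.I * (k.form y (sndTangent (v 0)) (sndTangent (v 1))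
        - k.form y (sndTangent (v 1)) (sndTangent (v 0))) := by
  rw [← mfderiv_snd_apply, ← mfderiv_snd_apply]
  rfl

theorem wedge_pullback_conj_pullback_apply (α : OneForm 𝓘(ℂ, EX) X) (β : OneForm 𝓘(ℂ, EY) Y)
    (x : X) (y : Y) (v : Fin 2 → TangentSpace (𝓘(ℂ, EX).prod 𝓘(ℂ, EY)) (x, y)) :
    OneForm.wedge (OneForm.pullback (𝓘(ℂ, EX).prod 𝓘(ℂ, EY)) (Prod.fst : X × Y → X) α)
      (OneForm.conj (OneForm.pullback (𝓘(ℂ, EX).prod 𝓘(ℂ, EY)) (Prod.snd : X × Y → Y) β)) (x, y) v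
      = α x (fstTangent (v 0)) * conj (β y (sndTangent (v 1)))
        - α x (fstTangent (v 1)) * conj (β y (sndTangent (v 0))) := by
  rw [← mfderiv_fst_apply, ← mfderiv_fst_apply, ← mfderiv_snd_apply, ← mfderiv_snd_apply]
  rfl

theorem TwoForm.sum_apply {E : Type*} [NormedAddCommGroup E] [NormedSpace ℂ E]
    {H : Type*} [TopologicalSpace H] {I : ModelWithCorners ℂ E H} {M : Type*} [TopologicalSpace M]
    [ChartedSpace H M] {ι : Type*} (t : Finset ι) (η : ι → TwoForm I M) (p : M)
    (v : Fin 2 → TangentSpace I p) : (∑ i ∈ t, η i) p v = ∑ i ∈ t, η i p v :=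
  map_sum ({ toFun := fun η => η p v, map_zero' := rfl, map_add' := fun _ _ => rfl } :
    TwoForm I M →+ ℂ) η t

theorem sum_wedge_apply {r s : ℕ} (a : Fin r → Fin s → ℂ) (α : Fin r → OneForm 𝓘(ℂ, EX) X)
    (β : Fin s → OneForm 𝓘(ℂ, EY) Y) (x : X) (y : Y)
    (v : Fin 2 → TangentSpace (𝓘(ℂ, EX).prod 𝓘(ℂ, EY)) (x, y)) :
    (Complex.I • ∑ k, ∑ l, a k l •
      OneForm.wedge (OneForm.pullback (𝓘(ℂ, EX).prod 𝓘(ℂ, EY)) (Prod.fst : X × Y → X) (α k))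
        (OneForm.conj (OneForm.pullback (𝓘(ℂ, EX).prod 𝓘(ℂ, EY)) (Prod.snd : X × Y → Y) (β l))) :
        TwoForm (𝓘(ℂ, EX).prod 𝓘(ℂ, EY)) (X × Y)) (x, y) v
      = Complex.I * ((∑ k, ∑ l, a k l * (α k x (fstTangent (v 0)) * conj (β l y (sndTangent (v 1)))))
        - ∑ k, ∑ l, a k l * (α k x (fstTangent (v 1)) * conj (β l y (sndTangent (v 0))))) := by
  rw [Pi.smul_apply, AlternatingMap.smul_apply, smul_eq_mul, TwoForm.sum_apply,
    ← Finset.sum_sub_distrib]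
  congr 1
  refine Finset.sum_congr rfl fun k _ => ?_
  rw [TwoForm.sum_apply, ← Finset.sum_sub_distrib]
  refine Finset.sum_congr rfl fun l _ => ?_
  rw [Pi.smul_apply, AlternatingMap.smul_apply, smul_eq_mul, wedge_pullback_conj_pullback_apply,
    mul_sub]

end Assembly

end ComplexProduct

/-! ### The decomposition of the Kähler form -/

open ComplexProduct
theorem mainTheorem1
    {EX : Type*} [NormedAddCommGroup EX] [NormedSpace ℂ EX] [FiniteDimensional ℂ EX]
    {EY : Type*} [NormedAddCommGroup EY] [NormedSpace ℂ EY] [FiniteDimensional ℂ EY]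
    {X : Type*} [TopologicalSpace X] [ChartedSpace EX X] [IsManifold 𝓘(ℂ, EX) ω X]
    [T2Space X] [CompactSpace X] [ConnectedSpace X]
    {Y : Type*} [TopologicalSpace Y] [ChartedSpace EY Y] [IsManifold 𝓘(ℂ, EY) ω Y]
    [T2Space Y] [CompactSpace Y] [ConnectedSpace Y]
    {r s : ℕ}
    (φ : Module.Basis (Fin r) ℂ (HolomorphicOneForm 𝓘(ℂ, EX) X))
    (ψ : Module.Basis (Fin s) ℂ (HolomorphicOneForm 𝓘(ℂ, EY) Y))
    (h : HermitianMetric (𝓘(ℂ, EX).prod 𝓘(ℂ, EY)) (X × Y))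
    (hh : h.NonposBisectionalCurvature) :
    ∃ (h₁ : HermitianMetric 𝓘(ℂ, EX) X) (h₂ : HermitianMetric 𝓘(ℂ, EY) Y)
      (a : Fin r → Fin s → ℂ) (ρ : TwoForm (𝓘(ℂ, EX).prod 𝓘(ℂ, EY)) (X × Y)),
      h₁.NonposBisectionalCurvature ∧ h₂.NonposBisectionalCurvature ∧
      ρ = Complex.I • ∑ k, ∑ l, a k l •
        OneForm.wedge (OneForm.pullback _ Prod.fst (HolomorphicOneForm.toOneForm (φ k)))
          (OneForm.conj (OneForm.pullback _ Prod.snd (HolomorphicOneForm.toOneForm (ψ l)))) ∧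
      h.kahlerForm =
        TwoForm.pullback _ Prod.fst h₁.kahlerForm + TwoForm.pullback _ Prod.snd h₂.kahlerForm
          + ρ + TwoForm.conj ρ := by
  obtain ⟨a, ha⟩ := hh.exists_form_inl_inr_eq φ ψ
  have hx := mem_extChartAt_target (I := 𝓘(ℂ, EX)) (Classical.arbitrary X)
  have hy := mem_extChartAt_target (I := 𝓘(ℂ, EY)) (Classical.arbitrary Y)
  -- The metrics are induced on the slices through arbitrary base points; the diagonal blocks do not
  -- depend on this choice.
  refine ⟨h.restrictFst hy, h.restrictSnd hx, a, _, hh.restrictFst hy, hh.restrictSnd hx, rfl, ?_⟩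
  funext ⟨x, y⟩
  ext v
  -- The four blocks of `h`: the diagonal ones are moved to the base slices, and the second mixed
  -- block is the conjugate of the first with `i` and `j` exchanged.
  have hsplit : ∀ i j, h.form (x, y) (v i) (v j)
      = (h.restrictFst hy).form x (fstTangent (v i)) (fstTangent (v j))
        + (h.restrictSnd hx).form y (sndTangent (v i)) (sndTangent (v j))
        + h.form (x, y) (inlTangent x y (fstTangent (v i))) (inrTangent x y (sndTangent (v j)))
        + conj (h.form (x, y) (inlTangent x y (fstTangent (v j)))
          (inrTangent x y (sndTangent (v i)))) := fun i j => by
    have e1 : (h.restrictFst hy).form x (fstTangent (v i)) (fstTangent (v j))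
        = h.form (x, y) (inlTangent x y (fstTangent (v i))) (inlTangent x y (fstTangent (v j))) :=
      hh.form_inl_inl_eq x _ _ _ y
    have e2 : (h.restrictSnd hx).form y (sndTangent (v i)) (sndTangent (v j))
        = h.form (x, y) (inrTangent x y (sndTangent (v i))) (inrTangent x y (sndTangent (v j))) :=
      hh.form_inr_inr_eq y _ _ _ x
    rw [e1, e2, h.conj_symm]
    conv_lhs => rw [← inlTangent_add_inrTangent (v i), ← inlTangent_add_inrTangent (v j)]
    rw [map_add, map_add, add_apply, add_apply]
    ring
  have hρ := sum_wedge_apply a (fun k => HolomorphicOneForm.toOneForm (φ k))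
    (fun l => HolomorphicOneForm.toOneForm (ψ l)) x y v
  simp only [← ha] at hρ
  rw [Pi.add_apply, Pi.add_apply, Pi.add_apply, AlternatingMap.add_apply, AlternatingMap.add_apply,
    AlternatingMap.add_apply, h.kahlerForm_apply, pullback_fst_kahlerForm_apply,
    pullback_snd_kahlerForm_apply, hsplit 0 1, hsplit 1 0]
  -- After antisymmetrization the first mixed block is `ρ`. Conjugation changes the sign of the
  -- factor `i`, which matches the exchange of arguments in the second block, so that block is the
  -- conjugate of `ρ`.
  refine Eq.trans ?_ (congrArg₂ (fun b c => _ + b + c) hρ.symm (congrArg (starRingEnd ℂ) hρ.symm))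
  simp only [map_mul, map_sub, Complex.conj_I]
  ring
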